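/- **Setting.** Let $T>0$, let $d,m,n$ be positive integers, $\alpha\in(0,1]$, and let $W:[0,T]\to\mathbb{R}^n$ be $\alpha$-Hölder continuous; write $\delta W_{s,t}=W_t-W_s$. $\mathcal{P}_2(\mathbb{R}^d)$ is the set of Borel probability measures on $\mathbb{R}^d$ with finite second moment, with the 2-Wasserstein distance $\mathcal{W}_2$ and its Borel $\sigma$-algebra. For finite-dimensional $F$, a map $g:\mathcal{P}_2(\mathbb{R}^d)\to F$ is *continuously L-differentiable* if its lift $X\mapsto g(\mathcal{L}_X)$ on $L_2(\Omega_0;\mathbb{R}^d)$ is continuously Fréchet differentiable, where $\Omega_0$ is an atomless Polish probability space (here $[0,1]$ with Lebesgue measure) and $\mathcal{L}_X$ is the law of $X$; a *version* of its L-derivative is a map $(\mu,v)\mapsto\partial_\mu g(\mu)(v)\in\mathscr{L}(\mathbb{R}^d,F)$ with $\partial_\mu g(\mu)\in L_2(\mu)$ such that the Fréchet derivative of the lift at $X$ is $Y\mapsto\mathbb{E}[\partial_\mu g(\mathcal{L}_X)(X)\,Y]$. Call a function of $t\in[0,T]$ and further variables (points of $\mathbb{R}^d$, with the Euclidean distance,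 and elements of $\mathcal{P}_2(\mathbb{R}^d)$, with $\mathcal{W}_2$) *regular* if it is globally bounded, Lipschitz in the further variables uniformly in $t$, and $\alpha$-Hölder in $t$ uniformly in the further variables. **Assumptions.** $b:[0,T]\times\mathbb{R}^d\times\mathcal{P}_2(\mathbb{R}^d)\to\mathbb{R}^d$ and $\sigma:[0,T]\times\mathbb{R}^d\times\mathcal{P}_2(\mathbb{R}^d)\to\mathscr{L}(\mathbb{R}^m,\mathbb{R}^d)$ are Borel measurable, bounded, and Lipschitz in $(x,\mu)$ uniformly in $t$. $f:[0,T]\times\mathbb{R}^d\times\mathcal{P}_2(\mathbb{R}^d)\to\mathscr{L}(\mathbb{R}^n,\mathbb{R}^d)$ is Borel measurable and bounded, and - (a) $x\mapsto f(t,x,\mu)$ is twice differentiable, $D_xf$ is bounded and $D_x^2f$ is regular in $(t,x,\mu)$; - (b) $\mu\mapsto D_xf(t,x,\mu)$ is continuously L-differentiable, with a version $\partial_\mu D_xf(t,x,\mu)(v)$ regular in $(t,x,\mu,v)$; - (c) $\mu\mapsto f(t,x,\mu)$ is continuously L-differentiable, with a bounded version $\partial_\mu f(t,x,\mu)(v)$;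 - (d) this version is differentiable in $v$, and $D_v\partial_\mu f$ is regular in $(t,x,\mu,v)$; - (e) this version is, for fixed $(t,x,v)$, continuously L-differentiable in $\mu$, with a version $\partial_\mu^2f(t,x,\mu)(v,v')$ regular in $(t,x,\mu,v,v')$; - (f) this version is differentiable in $x$, and $D_x\partial_\mu f$ is regular in $(t,x,\mu,v)$. $f':[0,T]\times\mathbb{R}^d\times\mathcal{P}_2(\mathbb{R}^d)\to\mathscr{L}(\mathbb{R}^n\otimes\mathbb{R}^n,\mathbb{R}^d)\cong\mathscr{L}(\mathbb{R}^n,\mathscr{L}(\mathbb{R}^n,\mathbb{R}^d))$ is Borel measurable, bounded, and $\alpha$-Hölder in $t$ uniformly in $(x,\mu)$, and - (g) $x\mapsto f'(t,x,\mu)$ is differentiable and $D_xf'$ is regular in $(t,x,\mu)$; - (h) $\mu\mapsto f'(t,x,\mu)$ is continuously L-differentiable, with a version $\partial_\mu f'(t,x,\mu)(v)$ regular in $(t,x,\mu,v)$; - (i)–(k) there is a constant $C$ such that, for all $0\le s<t\le T$, $x,v\in\mathbb{R}^d$ and $\mu\in\mathcal{P}_2(\mathbb{R}^d)$, the norms of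 $f(t,x,\mu)-f(s,x,\mu)-f'(s,x,\mu)\delta W_{s,t}$, of $D_xf(t,x,\mu)-D_xf(s,x,\mu)-D_xf'(s,x,\mu)\delta W_{s,t}$ and of $\partial_\mu f(t,x,\mu)(v)-\partial_\mu f(s,x,\mu)(v)-\partial_\mu f'(s,x,\mu)(v)\delta W_{s,t}$ are at most $C|t-s|^{2\alpha}$. **Function spaces.** Let $\mathcal{X}$ be a Banach space continuously embedded in a topological vector space $E$, let $\mathcal{Y}$ be a Banach space and $g:E\to\mathcal{Y}$. For $\gamma\in(0,1]$, $g$ is $\gamma$-Hölder along $\mathcal{X}$ (Lipschitz along $\mathcal{X}$ if $\gamma=1$) if $[g]_{\gamma;\mathcal{X}}=\sup|g(x)-g(y)|/|x-y|_{\mathcal{X}}^\gamma<\infty$, the supremum being over $x\ne y$ in $E$ with $x-y\in\mathcal{X}$. The derivative $D^jg(x)$ along $\mathcal{X}$ is the $j$-th Fréchet derivative at $0$ of $\mathcal{X}\ni\xi\mapsto g(x+\xi)$. For $k=N+\gamma$ with $N\in\mathbb{N}_{\ge0}$ and $\gamma\in(0,1]$, $g\in C^k_{b,\mathcal{X}}(E;\mathcal{Y})$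 means that for each $x\in E$ the map $\mathcal{X}\ni\xi\mapsto g(x+\xi)$ is $N$ times Fréchet differentiable and $|g|_{C^k_b;\mathcal{X}}=\sum_{j=0}^N\sup_E|D^jg|+[D^Ng]_{\gamma;\mathcal{X}}<\infty$ (so $C^1_{b,\mathcal{X}}$ is the class of functions that are bounded and Lipschitz along $\mathcal{X}$). For $\kappa=N+\gamma$ with $N\ge1$ and $\gamma\in(0,1]$, $(g,g')\in\mathscr{D}^{2\alpha}_WC^\kappa_{b,\mathcal{X}}(E;\mathcal{Y})$ means that: - (i) $g_t\in C^\kappa_{b,\mathcal{X}}(E;\mathcal{Y})$ and $g'_t\in C^{\kappa-1}_{b,\mathcal{X}}(E;\mathscr{L}(\mathbb{R}^n,\mathcal{Y}))$ with norms bounded uniformly in $t\in[0,T]$, and $t\mapsto g_t$ and $t\mapsto g'_t$ are strongly measurable with respect to uniform convergence on $E$ of the functions and of their derivatives up to order $N$ and $N-1$ respectively; - (ii) $D^jg_t$ for $0\le j\le N$ and $D^jg'_t$ for $0\le j\le N-1$ are $\alpha$-Hölder in $t$ uniformly on $E$; - (iii) $\sup_{s<t}\sup_{x\in E}|D^jg_t(x)-D^jg_s(x)-D^jg'_s(x)\delta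 W_{s,t}|/|t-s|^{2\alpha}<\infty$ for $0\le j\le N-1$. **Statement.** Let $(\Omega,\mathcal{F},\mathbb{P})$ be an atomless probability space and define $\hat b_t(x,X)=b(t,x,\mathcal{L}_X)$ for $(x,X)\in E:=\mathbb{R}^d\times L_2(\Omega;\mathbb{R}^d)$, and $\hat\sigma,\hat f,\hat f'$ in the same way. Let $p\in(2,\infty)$ and $\mathcal{X}=\mathbb{R}^d\times L_p(\Omega;\mathbb{R}^d)$. Under the assumptions above: 1. for each $t\in[0,T]$, $\hat b_t\in C^1_{b,\mathcal{X}}(E;\mathbb{R}^d)$, and $\sup_{t\in[0,T]}\big(\sup_E|\hat b_t|+[\hat b_t]_{1;\mathcal{X}}\big)<\infty$; likewise $\hat\sigma_t\in C^1_{b,\mathcal{X}}(E;\mathscr{L}(\mathbb{R}^m,\mathbb{R}^d))$ and $\sup_{t\in[0,T]}\big(\sup_E|\hat\sigma_t|+[\hat\sigma_t]_{1;\mathcal{X}}\big)<\infty$; 2. $(\hat f,\hat f')\in\mathscr{D}^{2\alpha}_WC^{p\wedge3}_{b,\mathcal{X}}\big(E;\mathscr{L}(\mathbb{R}^n,\mathbb{R}^d)\big)$.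 -/

import Mathlib

open MeasureTheory Set
open scoped ENNReal NNReal

noncomputable section

/-! ### Differentiability along a continuously embedded Banach space -/

section Along

variable {E X Y : Type*} [AddCommGroup E] [Module ℝ E] [TopologicalSpace E]
  [NormedAddCommGroup X] [NormedSpace ℝ X] [NormedAddCommGroup Y] [NormedSpace ℝ Y]

/-- The bound `|g(x) - g(y)| ≤ C |x - y|_X ^ γ` for all `x, y ∈ E` with `x - y ∈ X`, where
`ι : X → E` is the embedding. -/
def HolderAlongWith (ι : X →L[ℝ] E) (C γ : ℝ) (g : E → Y) : Prop :=
  ∀ (x : E) (ξ : X), ‖g (x + ι ξ) - g x‖ ≤ C * ‖ξ‖ ^ γ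

/-- The `j`-th Fréchet derivative of `g` along `X` at `x ∈ E`: the `j`-th derivative at `0` of
`ξ ↦ g (x + ξ)` on `X`. -/
def derivAlong (ι : X →L[ℝ] E) (j : ℕ) (g : E → Y) (x : E) :
    ContinuousMultilinearMap ℝ (fun _ : Fin j => X) Y :=
  iteratedFDeriv ℝ j (fun ξ : X => g (x + ι ξ)) 0

/-- For `k > 0`, the integer `N ≥ 0` with `k = N + γ` and `γ ∈ (0, 1]`. -/
def intOrder (k : ℝ) : ℕ := ⌈k⌉₊ - 1

/-- For `k > 0`, the number `γ ∈ (0, 1]` with `k = N + γ` and `N ≥ 0` an integer. -/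
def fracOrder (k : ℝ) : ℝ := k - intOrder k

/-- `g` lies in `C^k_{b,X}(E;Y)` and each term of its `C^k_b`-norm along `X` is at most `K`.
For `k = 1` this says that `g` is bounded and Lipschitz along `X`. -/
structure CkbAlongWith (ι : X →L[ℝ] E) (k K : ℝ) (g : E → Y) : Prop where
  /-- `ξ ↦ g (x + ξ)` is `N` times Fréchet differentiable on `X`. -/
  differentiable : ∀ x : E, ∀ j < intOrder k,
    Differentiable ℝ (iteratedFDeriv ℝ j (fun ξ : X => g (x + ι ξ)))
  bound : ∀ x : E, ‖g x‖ ≤ K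
  bound_deriv : ∀ j, 1 ≤ j → j ≤ intOrder k → ∀ x : E, ‖derivAlong ι j g x‖ ≤ K
  holder : HolderAlongWith ι K (fracOrder k) (derivAlong ι (intOrder k) g)

/-- The class `C^k_{b,X}(E;Y)`, for `k > 0`. -/
def MemCkbAlong (ι : X →L[ℝ] E) (k : ℝ) (g : E → Y) : Prop :=
  ∃ K : ℝ, CkbAlongWith ι k K g

/-- Deterministic controlled vector fields: `(f, f') ∈ D_W^{2α} C^κ_{b,X}(E;Y)`, `κ > 1`. -/
structure IsControlledVectorField {V : Type*} [NormedAddCommGroup V] [NormedSpace ℝ V]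
    (ι : X →L[ℝ] E) {T : ℝ} (α κ : ℝ) (W : Icc (0 : ℝ) T → V)
    (f : Icc (0 : ℝ) T → E → Y) (f' : Icc (0 : ℝ) T → E → (V →L[ℝ] Y)) : Prop where
  mem : ∃ K : ℝ, ∀ t, CkbAlongWith ι κ K (f t)
  mem' : ∃ K : ℝ, ∀ t, CkbAlongWith ι (κ - 1) K (f' t)
  /-- `t ↦ f_t` and `t ↦ f'_t` are strongly measurable, for uniform convergence of the functions
  and of their derivatives. -/
  measurable : ∀ j ≤ intOrder κ,
    StronglyMeasurable fun t => UniformFun.ofFun (fun x : E => derivAlong ι j (f t) x)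
  measurable' : ∀ j ≤ intOrder κ - 1,
    StronglyMeasurable fun t => UniformFun.ofFun (fun x : E => derivAlong ι j (f' t) x)
  holder : ∀ j ≤ intOrder κ, ∃ C : ℝ, ∀ s t : Icc (0 : ℝ) T, s < t → ∀ x : E,
    ‖derivAlong ι j (f t) x - derivAlong ι j (f s) x‖ ≤ C * |(t : ℝ) - s| ^ α
  holder' : ∀ j ≤ intOrder κ - 1, ∃ C : ℝ, ∀ s t : Icc (0 : ℝ) T, s < t → ∀ x : E,
    ‖derivAlong ι j (f' t) x - derivAlong ι j (f' s) x‖ ≤ C * |(t : ℝ) - s| ^ α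
  /-- The remainders of `f, Df, …, D^{N-1} f`; evaluation at `δW_{s,t}` takes
  `D^j f'_s(x)` to a multilinear map with values in `Y`. -/
  remainder : ∀ j ≤ intOrder κ - 1, ∃ C : ℝ, ∀ s t : Icc (0 : ℝ) T, s < t → ∀ x : E,
    ‖derivAlong ι j (f t) x - derivAlong ι j (f s) x
        - (ContinuousLinearMap.apply ℝ Y (W t - W s)).compContinuousMultilinearMap
            (derivAlong ι j (f' s) x)‖
      ≤ C * |(t : ℝ) - s| ^ (2 * α)

end Along

/-! ### Probability measures with finite second moment and Lions lifts -/

/-- Euclidean space `ℝ^d`. -/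
abbrev RSp (d : ℕ) : Type := EuclideanSpace ℝ (Fin d)

/-- `𝒫₂(ℝ^d)`. As a subtype of `Measure` it carries the σ-algebra generated by the evaluations
`μ ↦ μ(A)`, which is the Borel σ-algebra of the 2-Wasserstein distance. -/
abbrev P2 (d : ℕ) : Type :=
  {μ : Measure (RSp d) // IsProbabilityMeasure μ ∧ MemLp id 2 μ}

/-- The 2-Wasserstein distance, as an infimum over couplings. -/
def wass2 {d : ℕ} (μ ν : P2 d) : ℝ :=
  (⨅ (π : Measure (RSp d × RSp d)) (_ : π.map Prod.fst = μ.1 ∧ π.map Prod.snd = ν.1),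
    (∫⁻ z, ‖z.1 - z.2‖ₑ ^ (2 : ℝ) ∂π) ^ (1 / 2 : ℝ)).toReal

section Lift

variable {Ω : Type*} [MeasurableSpace Ω]

/-- A measure without atoms: each set of positive measure has a subset of strictly smaller
positive measure. -/
def IsAtomless (P : Measure Ω) : Prop :=
  ∀ A, MeasurableSet A → 0 < P A → ∃ B ⊆ A, MeasurableSet B ∧ 0 < P B ∧ P B < P A

variable {d : ℕ} (P : Measure Ω) [IsProbabilityMeasure P]

/-- The law of a square integrable random variable. -/
def lawL2 (X : Lp (RSp d) 2 P) : P2 d :=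
  ⟨P.map X, Measure.isProbabilityMeasure_map (Lp.aestronglyMeasurable X).aemeasurable, by
    have h := (Lp.aestronglyMeasurable X).aemeasurable
    exact (memLp_map_measure_iff aestronglyMeasurable_id h).2 (Lp.memLp X)⟩

/-- The Lions lift of `g : 𝒫₂(ℝ^d) → F` to `L₂(Ω;ℝ^d)`. -/
def lionsLift {F : Type*} (g : P2 d → F) : Lp (RSp d) 2 P → F := fun X => g (lawL2 P X)

/-- The Lions lift of a coefficient: `ĝ_t(x, X) = g(t, x, Law X)`. -/
def liftCoeff {F S : Type*} (g : S → RSp d → P2 d → F) (t : S) :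
    RSp d × Lp (RSp d) 2 P → F :=
  fun z => g t z.1 (lawL2 P z.2)

/-- The inclusion `L_p ⊆ L_2` on a probability space, for `p ≥ 2`. -/
def lpInclusion (p : ℝ≥0∞) [Fact (1 ≤ p)] (hp : 2 ≤ p) : Lp (RSp d) p P →L[ℝ] Lp (RSp d) 2 P :=
  LinearMap.mkContinuous
    { toFun := fun X => ((Lp.memLp X).mono_exponent hp).toLp X
      map_add' := fun X Y => by
        rw [← MemLp.toLp_add, MemLp.toLp_eq_toLp_iff]
        exact Lp.coeFn_add X Y
      map_smul' := fun c X => by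
        rw [RingHom.id_apply, ← MemLp.toLp_const_smul, MemLp.toLp_eq_toLp_iff]
        exact Lp.coeFn_smul c X } 1
    (fun X => by
      rw [one_mul]
      change ‖((Lp.memLp X).mono_exponent hp).toLp X‖ ≤ ‖X‖
      rw [Lp.norm_toLp, Lp.norm_def]
      exact ENNReal.toReal_mono (Lp.eLpNorm_ne_top X)
        (eLpNorm_le_eLpNorm_of_exponent_le hp (Lp.aestronglyMeasurable X)))

/-- The continuous embedding of `ℝ^d × L_p(Ω;ℝ^d)` into `ℝ^d × L_2(Ω;ℝ^d)`, for `p ≥ 2`.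
(Both products carry the maximum norm, which is equivalent to the sum of the norms.) -/
def stateEmbedding (p : ℝ≥0∞) [Fact (1 ≤ p)] (hp : 2 ≤ p) :
    RSp d × Lp (RSp d) p P →L[ℝ] RSp d × Lp (RSp d) 2 P :=
  (ContinuousLinearMap.id ℝ (RSp d)).prodMap (lpInclusion P p hp)

end Lift

/-- `g : 𝒫₂(ℝ^d) → F` is continuously L-differentiable, and `dg` is a version of its L-derivative
`∂_μ g`. The lift is taken on the unit interval with Lebesgue measure, an atomless Polish
probability space. For finite-dimensional `F` this is the same as the condition on each component,
with `dg μ v` the linear map whose `(i, j)` entry is the `j`-th coordinate of `∂_μ g^i (μ)(v)`. -/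
structure HasLDeriv {d : ℕ} {F : Type*} [NormedAddCommGroup F] [NormedSpace ℝ F]
    (g : P2 d → F) (dg : P2 d → RSp d → (RSp d →L[ℝ] F)) : Prop where
  contDiff : ContDiff ℝ 1 (lionsLift (volume : Measure unitInterval) g)
  memLp : ∀ μ : P2 d, MemLp (dg μ) 2 μ.1
  fderiv_eq : ∀ X Y : Lp (RSp d) 2 (volume : Measure unitInterval),
    fderiv ℝ (lionsLift (volume : Measure unitInterval) g) X Y
      = ∫ ω, dg (lawL2 volume X) (X ω) (Y ω)

/-! ### Assumptions on the coefficients -/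

/-- `h` is globally bounded. -/
def GloballyBounded {S A F : Type*} [NormedAddCommGroup F] (h : S → A → F) : Prop :=
  ∃ K : ℝ, ∀ t a, ‖h t a‖ ≤ K

/-- `h` is Lipschitz in its second argument for the distance `ρ`, uniformly in the first. -/
def UniformlyLipschitz {S A F : Type*} [NormedAddCommGroup F] (ρ : A → A → ℝ) (h : S → A → F) :
    Prop :=
  ∃ L : ℝ, ∀ t a a', ‖h t a - h t a'‖ ≤ L * ρ a a'

/-- `h` is `α`-Hölder in time, uniformly in its second argument. -/
def UniformlyTimeHolder {T : ℝ} {A F : Type*} [NormedAddCommGroup F] (α : ℝ)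
    (h : Icc (0 : ℝ) T → A → F) : Prop :=
  ∃ C : ℝ, ∀ (s t : Icc (0 : ℝ) T) (a : A), ‖h t a - h s a‖ ≤ C * |(t : ℝ) - s| ^ α

/-- Globally bounded, Lipschitz in space uniformly in time, Hölder in time uniformly in space. -/
def BddLipHolder {T : ℝ} {A F : Type*} [NormedAddCommGroup F] (α : ℝ) (ρ : A → A → ℝ)
    (h : Icc (0 : ℝ) T → A → F) : Prop :=
  GloballyBounded h ∧ UniformlyLipschitz ρ h ∧ UniformlyTimeHolder α h

/-- Distance on pairs `(x, μ)`. -/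
def distXM {d : ℕ} (a b : RSp d × P2 d) : ℝ := ‖a.1 - b.1‖ + wass2 a.2 b.2

/-- Distance on triples `(x, μ, v)`. -/
def distXMV {d : ℕ} (a b : RSp d × P2 d × RSp d) : ℝ :=
  ‖a.1 - b.1‖ + wass2 a.2.1 b.2.1 + ‖a.2.2 - b.2.2‖

/-- Distance on quadruples `(x, μ, v, v')`. -/
def distXMVV {d : ℕ} (a b : RSp d × P2 d × RSp d × RSp d) : ℝ :=
  ‖a.1 - b.1‖ + wass2 a.2.1 b.2.1 + ‖a.2.2.1 - b.2.2.1‖ + ‖a.2.2.2 - b.2.2.2‖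

/-- Assumptions on `b` and `σ`: Borel measurable, bounded, Lipschitz in `(x, μ)` uniformly
in time. -/
structure BddLipCoeff {d : ℕ} {T : ℝ} {F : Type*} [NormedAddCommGroup F] [MeasurableSpace F]
    (g : Icc (0 : ℝ) T → RSp d → P2 d → F) : Prop where
  measurable : Measurable fun z : Icc (0 : ℝ) T × RSp d × P2 d => g z.1 z.2.1 z.2.2
  bounded : GloballyBounded fun t (a : RSp d × P2 d) => g t a.1 a.2
  lipschitz : UniformlyLipschitz distXM fun t (a : RSp d × P2 d) => g t a.1 a.2

/-- Assumptions on the rough coefficient `(f, f')`, for given versions `dμDxf`, `dμf`, `dμμf`,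
`dμf'` of the L-derivatives `∂_μ D_x f`, `∂_μ f`, `∂_μ² f`, `∂_μ f'`. The values of `f` lie in `F`
(to be `ℒ(ℝⁿ, ℝ^d)`), and those of `f'` in `ℒ(V, F)` (to be `ℒ(ℝⁿ, ℒ(ℝⁿ, ℝ^d))`, that is
`ℒ(ℝⁿ ⊗ ℝⁿ, ℝ^d)`), the argument in `V` being the increment of `W`. -/
structure RoughCoeffWith {d : ℕ} {T : ℝ} {V F : Type*}
    [NormedAddCommGroup V] [NormedSpace ℝ V] [NormedAddCommGroup F] [NormedSpace ℝ F]
    [MeasurableSpace F] (α : ℝ) (W : Icc (0 : ℝ) T → V)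
    (f : Icc (0 : ℝ) T → RSp d → P2 d → F)
    (f' : Icc (0 : ℝ) T → RSp d → P2 d → (V →L[ℝ] F))
    (dμDxf : Icc (0 : ℝ) T → RSp d → P2 d → RSp d → (RSp d →L[ℝ] RSp d →L[ℝ] F))
    (dμf : Icc (0 : ℝ) T → RSp d → P2 d → RSp d → (RSp d →L[ℝ] F))
    (dμμf : Icc (0 : ℝ) T → RSp d → P2 d → RSp d → RSp d → (RSp d →L[ℝ] RSp d →L[ℝ] F))
    (dμf' : Icc (0 : ℝ) T → RSp d → P2 d → RSp d → (RSp d →L[ℝ] V →L[ℝ] F)) : Prop where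
  measurable : Measurable fun z : Icc (0 : ℝ) T × RSp d × P2 d => f z.1 z.2.1 z.2.2
  bounded : GloballyBounded fun t (a : RSp d × P2 d) => f t a.1 a.2
  -- (a)
  diff_x : ∀ t μ, Differentiable ℝ fun x => f t x μ
  diff_xx : ∀ t μ, Differentiable ℝ (fderiv ℝ fun x => f t x μ)
  bounded_x : GloballyBounded fun t (a : RSp d × P2 d) => fderiv ℝ (fun x => f t x a.2) a.1
  regular_xx : BddLipHolder α distXM fun t (a : RSp d × P2 d) =>
    fderiv ℝ (fderiv ℝ fun x => f t x a.2) a.1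
  -- (b)
  lDeriv_x : ∀ t x, HasLDeriv (fun μ => fderiv ℝ (fun y => f t y μ) x) (dμDxf t x)
  regular_xμ : BddLipHolder α distXMV fun t (a : RSp d × P2 d × RSp d) =>
    dμDxf t a.1 a.2.1 a.2.2
  -- (c)
  lDeriv : ∀ t x, HasLDeriv (fun μ => f t x μ) (dμf t x)
  bounded_μ : GloballyBounded fun t (a : RSp d × P2 d × RSp d) => dμf t a.1 a.2.1 a.2.2
  -- (d)
  diff_v : ∀ t x μ, Differentiable ℝ fun v => dμf t x μ v
  regular_vμ : BddLipHolder α distXMV fun t (a : RSp d × P2 d × RSp d) =>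
    fderiv ℝ (fun v => dμf t a.1 a.2.1 v) a.2.2
  -- (e)
  lDeriv_μ : ∀ t x v, HasLDeriv (fun μ => dμf t x μ v) (fun μ => dμμf t x μ v)
  regular_μμ : BddLipHolder α distXMVV fun t (a : RSp d × P2 d × RSp d × RSp d) =>
    dμμf t a.1 a.2.1 a.2.2.1 a.2.2.2
  -- (f)
  diff_xμ : ∀ t μ v, Differentiable ℝ fun x => dμf t x μ v
  regular_μx : BddLipHolder α distXMV fun t (a : RSp d × P2 d × RSp d) =>
    fderiv ℝ (fun x => dμf t x a.2.1 a.2.2) a.1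
  measurable' : Measurable fun z : Icc (0 : ℝ) T × RSp d × P2 d => f' z.1 z.2.1 z.2.2
  bounded' : GloballyBounded fun t (a : RSp d × P2 d) => f' t a.1 a.2
  holder' : UniformlyTimeHolder α fun t (a : RSp d × P2 d) => f' t a.1 a.2
  -- (g)
  diff_x' : ∀ t μ, Differentiable ℝ fun x => f' t x μ
  regular_x' : BddLipHolder α distXM fun t (a : RSp d × P2 d) =>
    fderiv ℝ (fun x => f' t x a.2) a.1
  -- (h)
  lDeriv' : ∀ t x, HasLDeriv (fun μ => f' t x μ) (dμf' t x)
  regular_μ' : BddLipHolder α distXMV fun t (a : RSp d × P2 d × RSp d) =>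
    dμf' t a.1 a.2.1 a.2.2
  -- (i), (j), (k): `f`, `D_x f`, `∂_μ f` are controlled in time
  remainder : ∃ C : ℝ, ∀ s t : Icc (0 : ℝ) T, s < t → ∀ x μ,
    ‖f t x μ - f s x μ - f' s x μ (W t - W s)‖ ≤ C * |(t : ℝ) - s| ^ (2 * α)
  remainder_x : ∃ C : ℝ, ∀ s t : Icc (0 : ℝ) T, s < t → ∀ x μ,
    ‖fderiv ℝ (fun y => f t y μ) x - fderiv ℝ (fun y => f s y μ) x
        - (fderiv ℝ (fun y => f' s y μ) x).flip (W t - W s)‖ ≤ C * |(t : ℝ) - s| ^ (2 * α)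
  remainder_μ : ∃ C : ℝ, ∀ s t : Icc (0 : ℝ) T, s < t → ∀ x μ v,
    ‖dμf t x μ v - dμf s x μ v - (dμf' s x μ v).flip (W t - W s)‖ ≤ C * |(t : ℝ) - s| ^ (2 * α)

/-- The standing assumptions on the coefficients `b, σ, f, f'`. -/
structure CoeffAssumptions {d m n : ℕ} {T : ℝ} (α : ℝ) (W : Icc (0 : ℝ) T → RSp n)
    (b : Icc (0 : ℝ) T → RSp d → P2 d → RSp d)
    (σ : Icc (0 : ℝ) T → RSp d → P2 d → (RSp m →L[ℝ] RSp d))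
    (f : Icc (0 : ℝ) T → RSp d → P2 d → (RSp n →L[ℝ] RSp d))
    (f' : Icc (0 : ℝ) T → RSp d → P2 d → (RSp n →L[ℝ] RSp n →L[ℝ] RSp d)) : Prop where
  drift : BddLipCoeff b
  diffusion : BddLipCoeff σ
  rough : ∃ dμDxf dμf dμμf dμf', RoughCoeffWith α W f f' dμDxf dμf dμμf dμf'

end

set_option linter.unusedSectionVars false

/-! The lift of `f` depends on `X` only through its law, and `X ↦ law X` is 1-Lipschitz from `L₂` to
`𝒲₂`, which settles `b` and `σ`. For `f`, L-differentiability is given only on `[0,1]`; but the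
Taylor remainder at `X` in direction `H` depends only on the joint law of `(X, H)`, and every such
law is realised on `[0,1]`. So the mean value inequality there yields first-order expansions on `Ω`
(`HasLDeriv.norm_expansion_le`, `LiftC1.norm_expansion_le`).

The first derivative of the lift is `(h, H) ↦ D_x f h + 𝔼[∂_μ f(X) H]`, and it is Lipschitz already
for the `L₂` norm. The second derivative gathers `D_x²f`, `∂_μ D_x f`, `D_x ∂_μ f`, `∂_μ² f` and the
local term `𝔼[D_v ∂_μ f(X)(K, H)]`. The first four contribute forms that are Lipschitz for `L₂`. The
local term is the obstruction: its increment involves the pointwise size `|ξ(ω)|`, which is not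
uniformly small when `ξ` is small in `L₂`. Being both bounded and Lipschitz, `D_v ∂_μ f` has an
increment of order `|ξ(ω)|^θ`, apart from a part depending only on `‖ξ‖`, for every `θ ∈ (0, 1]`,
and `𝔼[|ξ|^θ |K| |H|]` is finite by Hölder's inequality once `2 + θ ≤ p`
(`integral_rpow_mul_mul_le`). The largest admissible value is `θ = min(p, 3) - 2`, whence the order
`p ∧ 3`. The same exponent controls the expansion of the first derivative
(`LiftC2.norm_liftDeriv_expansion_le`) and the Hölder seminorm of the second
(`LiftC2.norm_liftDeriv₂_sub_apply_le`).

The time conditions are softer. At a fixed point the lifted derivatives are linear in the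
derivatives of `f`, so uniform bounds on time increments and remainders pass to the lift. Strong
measurability follows from time-Hölder continuity in the uniform topology. -/

noncomputable section

/-! ### Pairing of square integrable functions -/

section Pairing

variable {Ω : Type*} [MeasurableSpace Ω] {P : Measure Ω}
  {U F G : Type*} [NormedAddCommGroup U] [NormedSpace ℝ U]
  [NormedAddCommGroup F] [NormedSpace ℝ F] [CompleteSpace F]
  [NormedAddCommGroup G] [NormedSpace ℝ G] [CompleteSpace G]

open Classical in
/-- The operator `H ↦ ∫ a(ω) H(ω) dP(ω)` on `L₂`, for a square integrable operator-valued `a`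
(and `0` if `a` is not square integrable). -/
def pairL2 (P : Measure Ω) (a : Ω → U →L[ℝ] F) : Lp U 2 P →L[ℝ] F :=
  if h : MemLp a 2 P then (ContinuousLinearMap.id ℝ (U →L[ℝ] F)).lpPairing P 2 2 (h.toLp a) else 0

theorem pairL2_apply {a : Ω → U →L[ℝ] F} (h : MemLp a 2 P) (H : Lp U 2 P) :
    pairL2 P a H = ∫ ω, a ω (H ω) ∂P := by
  rw [pairL2, dif_pos h, ContinuousLinearMap.lpPairing_eq_integral]
  refine integral_congr_ae ?_
  filter_upwards [h.coeFn_toLp] with ω hω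
  simp [hω]

theorem integrable_apply_of_memLp_two {a : Ω → U →L[ℝ] F} (h : MemLp a 2 P) (H : Lp U 2 P) :
    Integrable (fun ω => a ω (H ω)) P :=
  memLp_one_iff_integrable.1
    ((ContinuousLinearMap.id ℝ (U →L[ℝ] F)).memLp_of_bilin (p := 2) (q := 2) 1 h (Lp.memLp H))

theorem pairL2_sub {a b : Ω → U →L[ℝ] F} (ha : MemLp a 2 P) (hb : MemLp b 2 P) :
    pairL2 P (fun ω => a ω - b ω) = pairL2 P a - pairL2 P b := by
  ext H
  have hab : MemLp (fun ω => a ω - b ω) 2 P := ha.sub hb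
  rw [sub_apply, pairL2_apply ha, pairL2_apply hb, pairL2_apply hab,
    ← integral_sub (integrable_apply_of_memLp_two ha H) (integrable_apply_of_memLp_two hb H)]
  rfl

theorem memLp_comp_left {a : Ω → U →L[ℝ] F} (ha : MemLp a 2 P) (T : F →L[ℝ] G) :
    MemLp (fun ω => T.comp (a ω)) 2 P :=
  (ContinuousLinearMap.compL ℝ U F G T).comp_memLp' ha

theorem pairL2_comp_left {a : Ω → U →L[ℝ] F} (ha : MemLp a 2 P) (T : F →L[ℝ] G) :
    pairL2 P (fun ω => T.comp (a ω)) = T.comp (pairL2 P a) := by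
  ext H
  rw [pairL2_apply (memLp_comp_left ha T), ContinuousLinearMap.comp_apply, pairL2_apply ha,
    ← T.integral_comp_comm (integrable_apply_of_memLp_two ha H)]
  rfl

/-- Keeps the integrand instead of taking the operator norm on `L₂`, so that a bound valid only for
directions in `L_p` can be extracted afterwards by Hölder's inequality. -/
theorem norm_pairL2_apply_le (a : Ω → U →L[ℝ] F) (H : Lp U 2 P) :
    ‖pairL2 P a H‖ ≤ ∫ ω, ‖a ω‖ * ‖H ω‖ ∂P := by
  by_cases h : MemLp a 2 P
  · rw [pairL2_apply h]
    refine (norm_integral_le_integral_norm _).trans ?_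
    refine integral_mono_of_nonneg (.of_forall fun _ => norm_nonneg _) ?_
      (.of_forall fun ω => (a ω).le_opNorm _)
    exact h.norm.integrable_mul (Lp.memLp H).norm
  · rw [pairL2, dif_neg h]
    simpa using integral_nonneg fun ω => by positivity

/-- Domination of the norm of the pairing. -/
theorem norm_pairL2_le {a : Ω → U →L[ℝ] F} {b : Ω → ℝ} (hb : MemLp b 2 P)
    (h : ∀ᵐ ω ∂P, ‖a ω‖ ≤ b ω) : ‖pairL2 P a‖ ≤ (eLpNorm b 2 P).toReal := by
  by_cases ha : MemLp a 2 P
  · rw [pairL2, dif_pos ha]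
    refine ContinuousLinearMap.opNorm_le_bound _ ENNReal.toReal_nonneg fun H => ?_
    rw [ContinuousLinearMap.lpPairing_eq_integral]
    -- Hölder's inequality with `1 = 1/2 + 1/2`: the pairing is dominated by the `L₁` norm of the
    -- pointwise product.
    have h1 := (ContinuousLinearMap.id ℝ (U →L[ℝ] F)).norm_holder_apply_apply_le
      (r := 1) (ha.toLp a) H
    have h2 : ‖∫ ω, (ContinuousLinearMap.id ℝ (U →L[ℝ] F)) (ha.toLp a ω) (H ω) ∂P‖
        ≤ ‖(ContinuousLinearMap.id ℝ (U →L[ℝ] F)).holder 1 (ha.toLp a) H‖ := by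
      rw [L1.norm_eq_integral_norm]
      refine (norm_integral_le_integral_norm _).trans (le_of_eq (integral_congr_ae ?_))
      filter_upwards [(ContinuousLinearMap.id ℝ (U →L[ℝ] F)).coeFn_holder (r := 1)
        (ha.toLp a) H] with ω hω
      rw [hω]
    refine h2.trans (h1.trans ?_)
    gcongr
    calc ‖ContinuousLinearMap.id ℝ (U →L[ℝ] F)‖ * ‖ha.toLp a‖ ≤ 1 * ‖ha.toLp a‖ := by
          gcongr; exact ContinuousLinearMap.norm_id_le
      _ ≤ _ := by
          rw [one_mul, Lp.norm_toLp]
          refine ENNReal.toReal_mono hb.eLpNorm_ne_top (eLpNorm_mono_ae ?_)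
          filter_upwards [h] with ω hω
          exact hω.trans (le_abs_self _)
  · rw [pairL2, dif_neg ha]
    simp

theorem eLpNorm_affine_toReal_le [IsProbabilityMeasure P] {U' : Type*} [NormedAddCommGroup U']
    {C c : ℝ} (hC : 0 ≤ C) (hc : 0 ≤ c) (Z : Lp U' 2 P) :
    MemLp (fun ω => C * (c + ‖Z ω‖)) 2 P ∧
      (eLpNorm (fun ω => C * (c + ‖Z ω‖)) 2 P).toReal ≤ C * (c + ‖Z‖) := by
  have hZ : MemLp (fun ω => ‖Z ω‖) 2 P := (Lp.memLp Z).norm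
  have hcm : MemLp (fun _ : Ω => c) 2 P := memLp_const c
  refine ⟨(hcm.add hZ).const_mul C, ?_⟩
  have h1 : eLpNorm (fun ω => C * (c + ‖Z ω‖)) 2 P
      = ENNReal.ofReal C * eLpNorm ((fun _ => c) + fun ω => ‖Z ω‖) 2 P := by
    have := eLpNorm_const_smul (μ := P) (p := 2) C ((fun _ : Ω => c) + fun ω => ‖Z ω‖)
    rw [Real.enorm_eq_ofReal hC] at this
    exact this
  rw [h1, ENNReal.toReal_mul, ENNReal.toReal_ofReal hC]
  gcongr
  have h2 := eLpNorm_add_le (p := 2) hcm.1 hZ.1 one_le_two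
  refine (ENNReal.toReal_mono ?_ h2).trans ?_
  · exact ENNReal.add_ne_top.2 ⟨hcm.eLpNorm_ne_top, hZ.eLpNorm_ne_top⟩
  rw [ENNReal.toReal_add hcm.eLpNorm_ne_top hZ.eLpNorm_ne_top]
  gcongr
  · rw [eLpNorm_const _ (by norm_num) (NeZero.ne P)]
    simp [Real.enorm_eq_ofReal hc, hc]
  · rw [eLpNorm_norm, Lp.norm_def]

/-- The shape `C (c + |Z(ω)|)` is what a Lipschitz bound gives when one argument is random and the
others move by a deterministic amount `c`; Minkowski's inequality on a probability space then gives
the estimate. -/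
theorem norm_pairL2_le_affine [IsProbabilityMeasure P] {U' : Type*} [NormedAddCommGroup U']
    {C c : ℝ} (hC : 0 ≤ C) (hc : 0 ≤ c)
    (Z : Lp U' 2 P) {a : Ω → U →L[ℝ] F} (h : ∀ᵐ ω ∂P, ‖a ω‖ ≤ C * (c + ‖Z ω‖)) :
    ‖pairL2 P a‖ ≤ C * (c + ‖Z‖) :=
  (norm_pairL2_le (eLpNorm_affine_toReal_le hC hc Z).1 h).trans
    (eLpNorm_affine_toReal_le hC hc Z).2

theorem norm_pairL2_le_const [IsProbabilityMeasure P] {C : ℝ} (hC : 0 ≤ C) {a : Ω → U →L[ℝ] F}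
    (h : ∀ ω, ‖a ω‖ ≤ C) : ‖pairL2 P a‖ ≤ C := by
  have := norm_pairL2_le_affine (P := P) (U' := ℝ) (a := a) hC zero_le_one 0
    (.of_forall fun ω => (h ω).trans (by nlinarith [norm_nonneg ((0 : Lp ℝ 2 P) ω)]))
  simpa using this

end Pairing

/-! ### Transfer of random variables to the unit interval -/

section Transfer

open ProbabilityTheory

variable {Ω : Type*} [MeasurableSpace Ω] {d : ℕ}

/-- A measure on `ℝ^d × ℝ^d` with square integrable marginals is the joint law of two elements
of `L₂([0,1])`. -/
theorem exists_lp_unitInterval_map_eq (π : Measure (RSp d × RSp d)) [IsProbabilityMeasure π]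
    (h₁ : MemLp Prod.fst 2 π) (h₂ : MemLp Prod.snd 2 π) :
    ∃ X H : Lp (RSp d) 2 (volume : Measure unitInterval),
      (volume : Measure unitInterval).map (fun ω => (X ω, H ω)) = π := by
  -- Every Borel probability measure on a Polish space is an image of Lebesgue measure on `[0,1]`.
  obtain ⟨φ, hφ, hmap⟩ := Measure.exists_measurable_map_eq π
  subst hmap
  have e₁ : MemLp (fun ω => (φ ω).1) 2 (volume : Measure unitInterval) :=
    (memLp_map_measure_iff measurable_fst.aestronglyMeasurable hφ.aemeasurable).1 h₁
  have e₂ : MemLp (fun ω => (φ ω).2) 2 (volume : Measure unitInterval) :=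
    (memLp_map_measure_iff measurable_snd.aestronglyMeasurable hφ.aemeasurable).1 h₂
  refine ⟨e₁.toLp, e₂.toLp, Measure.map_congr ?_⟩
  filter_upwards [e₁.coeFn_toLp, e₂.coeFn_toLp] with ω h1 h2
  simp [h1, h2]

variable {P : Measure Ω} [IsProbabilityMeasure P]

theorem aemeasurable_lp (X : Lp (RSp d) 2 P) : AEMeasurable X P :=
  (Lp.aestronglyMeasurable X).aemeasurable

/-- The bridge from `Ω` to `[0,1]`: the pair is copied jointly, since the law of `X + H` and the
pairing of a function of `X` with `H` depend on the joint law. -/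
theorem exists_lp_unitInterval_identDistrib (X H : Lp (RSp d) 2 P) :
    ∃ X' H' : Lp (RSp d) 2 (volume : Measure unitInterval),
      IdentDistrib (fun ω => (X' ω, H' ω)) (fun ω => (X ω, H ω)) volume P := by
  have hm : AEMeasurable (fun ω => (X ω, H ω)) P := (aemeasurable_lp X).prodMk (aemeasurable_lp H)
  have := Measure.isProbabilityMeasure_map hm
  obtain ⟨X', H', h⟩ := exists_lp_unitInterval_map_eq (P.map fun ω => (X ω, H ω))
    ((memLp_map_measure_iff measurable_fst.aestronglyMeasurable hm).2 (Lp.memLp X))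
    ((memLp_map_measure_iff measurable_snd.aestronglyMeasurable hm).2 (Lp.memLp H))
  exact ⟨X', H', (aemeasurable_lp X').prodMk (aemeasurable_lp H'), hm, h⟩

variable {Ω' : Type*} [MeasurableSpace Ω'] {P' : Measure Ω'} [IsProbabilityMeasure P']

theorem lawL2_eq_of_identDistrib {X : Lp (RSp d) 2 P} {X' : Lp (RSp d) 2 P'}
    (h : IdentDistrib X' X P' P) : lawL2 P' X' = lawL2 P X :=
  Subtype.ext h.map_eq

theorem lawL2_add_eq_of_identDistrib {X H : Lp (RSp d) 2 P} {X' H' : Lp (RSp d) 2 P'}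
    (h : IdentDistrib (fun ω => (X' ω, H' ω)) (fun ω => (X ω, H ω)) P' P) :
    lawL2 P' (X' + H') = lawL2 P (X + H) := by
  refine Subtype.ext ?_
  change P'.map (X' + H' : Lp (RSp d) 2 P') = P.map (X + H : Lp (RSp d) 2 P)
  rw [Measure.map_congr (Lp.coeFn_add X' H'), Measure.map_congr (Lp.coeFn_add X H)]
  exact (h.comp (u := fun z : RSp d × RSp d => z.1 + z.2) (by fun_prop)).map_eq

theorem norm_eq_of_identDistrib {X : Lp (RSp d) 2 P} {X' : Lp (RSp d) 2 P'}
    (h : IdentDistrib X' X P' P) : ‖X'‖ = ‖X‖ := by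
  rw [Lp.norm_def, Lp.norm_def, h.eLpNorm_eq]

end Transfer

/-! ### The Wasserstein distance -/

section Wasserstein

open ProbabilityTheory

variable {Ω : Type*} [MeasurableSpace Ω] {P : Measure Ω} [IsProbabilityMeasure P] {d : ℕ}

theorem wass2_nonneg (μ ν : P2 d) : 0 ≤ wass2 μ ν := ENNReal.toReal_nonneg

theorem lp_enorm_sub_eq (X Y : Lp (RSp d) 2 P) :
    (∫⁻ z, ‖z.1 - z.2‖ₑ ^ (2 : ℝ) ∂(P.map fun ω => (X ω, Y ω))) ^ (1 / 2 : ℝ) = ‖X - Y‖ₑ := by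
  have hm : AEMeasurable (fun ω => (X ω, Y ω)) P := (aemeasurable_lp X).prodMk (aemeasurable_lp Y)
  rw [lintegral_map' (by fun_prop) hm, Lp.enorm_def,
    eLpNorm_eq_lintegral_rpow_enorm_toReal (by norm_num) (by norm_num)]
  simp only [ENNReal.toReal_ofNat]
  congr 1
  refine lintegral_congr_ae ?_
  filter_upwards [Lp.coeFn_sub X Y] with ω hω
  rw [hω]; rfl

/-- The joint law of `X` and `Y` is a coupling. The bound is kept in `ℝ≥0∞` because it also shows
that the infimum is finite, which `toReal` would hide. -/
theorem wass2_inf_le (X Y : Lp (RSp d) 2 P) :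
    (⨅ (π : Measure (RSp d × RSp d))
      (_ : π.map Prod.fst = (lawL2 P X).1 ∧ π.map Prod.snd = (lawL2 P Y).1),
      (∫⁻ z, ‖z.1 - z.2‖ₑ ^ (2 : ℝ) ∂π) ^ (1 / 2 : ℝ)) ≤ ‖X - Y‖ₑ := by
  have hm : AEMeasurable (fun ω => (X ω, Y ω)) P := (aemeasurable_lp X).prodMk (aemeasurable_lp Y)
  rw [← lp_enorm_sub_eq]
  refine iInf₂_le (P.map fun ω => (X ω, Y ω)) ⟨?_, ?_⟩
  · rw [AEMeasurable.map_map_of_aemeasurable (by fun_prop) hm]; rfl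
  · rw [AEMeasurable.map_map_of_aemeasurable (by fun_prop) hm]; rfl

theorem wass2_lawL2_le (X Y : Lp (RSp d) 2 P) : wass2 (lawL2 P X) (lawL2 P Y) ≤ ‖X - Y‖ := by
  rw [wass2, ← toReal_enorm (X - Y)]
  exact ENNReal.toReal_mono enorm_ne_top (wass2_inf_le X Y)

theorem wass2_lawL2_self (X : Lp (RSp d) 2 P) : wass2 (lawL2 P X) (lawL2 P X) = 0 :=
  le_antisymm (by simpa using wass2_lawL2_le X X) (wass2_nonneg _ _)

theorem memLp_fst_of_map_eq {π : Measure (RSp d × RSp d)} {μ : P2 d}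
    (h : π.map Prod.fst = μ.1) : MemLp Prod.fst 2 π := by
  have := μ.2.2
  rw [← h] at this
  exact (memLp_map_measure_iff aestronglyMeasurable_id measurable_fst.aemeasurable).1 this

theorem memLp_snd_of_map_eq {π : Measure (RSp d × RSp d)} {μ : P2 d}
    (h : π.map Prod.snd = μ.1) : MemLp Prod.snd 2 π := by
  have := μ.2.2
  rw [← h] at this
  exact (memLp_map_measure_iff aestronglyMeasurable_id measurable_snd.aemeasurable).1 this

/-- Every coupling comes from two elements of `L₂([0,1])`. -/
theorem exists_lp_unitInterval_of_coupling {μ ν : P2 d} {π : Measure (RSp d × RSp d)}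
    (h₁ : π.map Prod.fst = μ.1) (h₂ : π.map Prod.snd = ν.1) :
    ∃ X Y : Lp (RSp d) 2 (volume : Measure unitInterval), lawL2 volume X = μ ∧
      lawL2 volume Y = ν ∧ volume.map (fun ω => (X ω, Y ω)) = π := by
  have : IsProbabilityMeasure π := by
    have hμ := μ.2.1
    rw [← h₁] at hμ
    exact Measure.isProbabilityMeasure_of_map Prod.fst
  obtain ⟨X, Y, h⟩ := exists_lp_unitInterval_map_eq π (memLp_fst_of_map_eq h₁)
    (memLp_snd_of_map_eq h₂)
  have hm : AEMeasurable (fun ω => (X ω, Y ω)) (volume : Measure unitInterval) :=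
    (aemeasurable_lp X).prodMk (aemeasurable_lp Y)
  refine ⟨X, Y, Subtype.ext ?_, Subtype.ext ?_, h⟩
  · rw [← h₁, ← h, AEMeasurable.map_map_of_aemeasurable (by fun_prop) hm]; rfl
  · rw [← h₂, ← h, AEMeasurable.map_map_of_aemeasurable (by fun_prop) hm]; rfl

/-- A function whose lift to `L₂([0,1])` is Lipschitz is Lipschitz for `𝒲₂`. -/
theorem norm_sub_le_wass2 {F : Type*} [NormedAddCommGroup F] {g : P2 d → F} {K : ℝ} (hK : 0 ≤ K)
    (h : ∀ X Y : Lp (RSp d) 2 (volume : Measure unitInterval),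
      ‖g (lawL2 volume X) - g (lawL2 volume Y)‖ ≤ K * ‖X - Y‖) (μ ν : P2 d) :
    ‖g μ - g ν‖ ≤ K * wass2 μ ν := by
  have hμ := μ.2.1
  have hν := ν.2.1
  set J := ⨅ (π : Measure (RSp d × RSp d)) (_ : π.map Prod.fst = μ.1 ∧ π.map Prod.snd = ν.1),
    (∫⁻ z, ‖z.1 - z.2‖ₑ ^ (2 : ℝ) ∂π) ^ (1 / 2 : ℝ) with hJ
  -- The product coupling provides one pair with the given marginals, hence finiteness of the
  -- infimum.
  obtain ⟨X, Y, hX, hY, -⟩ := exists_lp_unitInterval_of_coupling (μ := μ) (ν := ν)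
      (π := μ.1.prod ν.1) (by simp) (by simp)
  have hfin : J ≠ ∞ := by
    rw [hJ, ← hX, ← hY]
    exact ((wass2_inf_le X Y).trans_lt enorm_lt_top).ne
  -- The comparison with the infimum divides by `K`; for `K = 0` a single realisation of the two
  -- marginals suffices.
  rcases hK.eq_or_lt with rfl | hK0
  · simpa [hX, hY] using h X Y
  have hK0' : ENNReal.ofReal K ≠ 0 := by simpa using hK0
  have key : ENNReal.ofReal ‖g μ - g ν‖ ≤ ENNReal.ofReal K * J := by
    rw [mul_comm, ← ENNReal.div_le_iff hK0' ENNReal.ofReal_ne_top]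
    refine le_iInf₂ fun π hπ => ?_
    obtain ⟨X, Y, hX, hY, hXY⟩ := exists_lp_unitInterval_of_coupling hπ.1 hπ.2
    rw [ENNReal.div_le_iff hK0' ENNReal.ofReal_ne_top, ← hXY, lp_enorm_sub_eq, mul_comm,
      ← ofReal_norm, ← ENNReal.ofReal_mul hK, ← hX, ← hY]
    exact ENNReal.ofReal_le_ofReal (h X Y)
  have := ENNReal.toReal_mono (ENNReal.mul_ne_top ENNReal.ofReal_ne_top hfin) key
  rwa [ENNReal.toReal_mul, ENNReal.toReal_ofReal (norm_nonneg _), ENNReal.toReal_ofReal hK] at this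

end Wasserstein

/-! ### Estimates for L-differentiable functions -/

section LDeriv

open ProbabilityTheory

variable {Ω : Type*} [MeasurableSpace Ω] {P : Measure Ω} [IsProbabilityMeasure P] {d : ℕ}
  {F : Type*} [NormedAddCommGroup F] [NormedSpace ℝ F] [CompleteSpace F]
  {g : P2 d → F} {dg : P2 d → RSp d → (RSp d →L[ℝ] F)}

/-- Square integrability of `∂_μ g(μ)` is a property of `μ` alone, so it pulls back to any space
carrying a variable of law `μ`. -/
theorem HasLDeriv.memLp_comp (h : HasLDeriv g dg) (X : Lp (RSp d) 2 P) :
    MemLp (fun ω => dg (lawL2 P X) (X ω)) 2 P :=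
  (memLp_map_measure_iff (h.memLp (lawL2 P X)).1 (aemeasurable_lp X)).1 (h.memLp (lawL2 P X))

theorem HasLDeriv.fderiv_eq_pairL2 (h : HasLDeriv g dg)
    (X : Lp (RSp d) 2 (volume : Measure unitInterval)) :
    fderiv ℝ (lionsLift volume g) X = pairL2 volume (fun ω => dg (lawL2 volume X) (X ω)) := by
  ext1 Y
  rw [h.fderiv_eq, pairL2_apply (h.memLp_comp X)]

/-- Mean value inequality for the lift on `L₂([0,1])`, followed by optimisation over couplings. -/
theorem HasLDeriv.norm_sub_le (h : HasLDeriv g dg) {K : ℝ} (hK : ∀ μ v, ‖dg μ v‖ ≤ K)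
    (μ ν : P2 d) : ‖g μ - g ν‖ ≤ K * wass2 μ ν := by
  have hK0 : 0 ≤ K := (norm_nonneg _).trans (hK μ 0)
  refine norm_sub_le_wass2 hK0 (fun X Y => ?_) μ ν
  have hd : Differentiable ℝ (lionsLift (volume : Measure unitInterval) g) :=
    h.contDiff.differentiable one_ne_zero
  refine convex_univ.norm_image_sub_le_of_norm_fderiv_le (𝕜 := ℝ)
    (f := lionsLift (volume : Measure unitInterval) g)
    (fun Z _ => hd Z) (fun Z _ => ?_) (mem_univ Y) (mem_univ X)
  rw [h.fderiv_eq_pairL2]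
  exact norm_pairL2_le_const hK0 fun ω => hK _ _

/-- First-order expansion of the lift, on an arbitrary probability space. -/
theorem HasLDeriv.norm_expansion_le (h : HasLDeriv g dg) {L : ℝ} (hL : 0 ≤ L)
    (hlip : ∀ μ ν v w, ‖dg μ v - dg ν w‖ ≤ L * (wass2 μ ν + ‖v - w‖)) (X H : Lp (RSp d) 2 P) :
    ‖g (lawL2 P (X + H)) - g (lawL2 P X) - pairL2 P (fun ω => dg (lawL2 P X) (X ω)) H‖
      ≤ 2 * L * ‖H‖ ^ 2 := by
  obtain ⟨X', H', hid⟩ := exists_lp_unitInterval_identDistrib X H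
  have hX : IdentDistrib X' X volume P := hid.comp measurable_fst
  have hH : IdentDistrib H' H volume P := hid.comp measurable_snd
  have hlaw := lawL2_eq_of_identDistrib hX
  -- Continuity in `v` makes `(v, h) ↦ dg μ v h` measurable, as the change of variables to the joint
  -- law requires.
  have hcont : Continuous (dg (lawL2 P X)) := by
    refine (LipschitzWith.of_dist_le_mul (K := ⟨L, hL⟩) fun v w => ?_).continuous
    rw [dist_eq_norm, dist_eq_norm]
    have := hlip (lawL2 P X) (lawL2 P X) v w
    rwa [wass2_lawL2_self, zero_add] at this
  have hpair : pairL2 P (fun ω => dg (lawL2 P X) (X ω)) H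
      = pairL2 volume (fun ω => dg (lawL2 volume X') (X' ω)) H' := by
    rw [pairL2_apply (h.memLp_comp X), pairL2_apply (h.memLp_comp X'), hlaw]
    have hφ : Continuous fun z : RSp d × RSp d => dg (lawL2 P X) z.1 z.2 := by fun_prop
    rw [← integral_map hid.aemeasurable_snd hφ.aestronglyMeasurable,
      ← integral_map hid.aemeasurable_fst hφ.aestronglyMeasurable, hid.map_eq]
  rw [← lawL2_add_eq_of_identDistrib hid, ← norm_eq_of_identDistrib hH, hpair, ← hlaw,
    ← h.fderiv_eq_pairL2]
  have hd : Differentiable ℝ (lionsLift (volume : Measure unitInterval) g) :=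
    h.contDiff.differentiable one_ne_zero
  have := (convex_segment X' (X' + H')).norm_image_sub_le_of_norm_fderiv_le' (𝕜 := ℝ)
    (f := lionsLift (volume : Measure unitInterval) g) (C := 2 * L * ‖H'‖)
    (φ := fderiv ℝ (lionsLift volume g) X')
    (fun Z _ => hd Z) (fun Z hZ => ?_) (left_mem_segment ℝ X' (X' + H'))
    (right_mem_segment ℝ X' (X' + H'))
  · rw [add_sub_cancel_left] at this
    calc _ ≤ _ := this
      _ = _ := by ring
  · have hZn : ‖Z - X'‖ ≤ ‖H'‖ := by
      have := norm_sub_le_of_mem_segment hZ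
      simpa using this
    rw [h.fderiv_eq_pairL2, h.fderiv_eq_pairL2,
      ← pairL2_sub (h.memLp_comp Z) (h.memLp_comp X')]
    -- The distance `‖Z - X'‖` occurs twice: once bounding `𝒲₂` between the laws, once from the
    -- pointwise displacement. This is the factor 2 in `2 * L`.
    have : ‖pairL2 volume (fun ω => dg (lawL2 volume Z) (Z ω) - dg (lawL2 volume X') (X' ω))‖
        ≤ L * (‖Z - X'‖ + ‖Z - X'‖) := by
      refine norm_pairL2_le_affine hL (norm_nonneg _) (Z - X') ?_
      filter_upwards [Lp.coeFn_sub Z X'] with ω hω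
      rw [hω]
      refine (hlip _ _ _ _).trans ?_
      gcongr
      · exact wass2_lawL2_le Z X'
      · rfl
    refine this.trans ?_
    nlinarith

end LDeriv

/-! ### First derivative of the lift of a coefficient -/

section StateForm

variable {Ω : Type*} [MeasurableSpace Ω] {P : Measure Ω} {d : ℕ}
  {F G : Type*} [NormedAddCommGroup F] [NormedSpace ℝ F] [CompleteSpace F]
  [NormedAddCommGroup G] [NormedSpace ℝ G] [CompleteSpace G]

/-- The linear form `(h, H) ↦ A h + 𝔼[a H]` on `ℝ^d × L₂`. -/
def stateForm (P : Measure Ω) (A : RSp d →L[ℝ] F) (a : Ω → RSp d →L[ℝ] F) :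
    RSp d × Lp (RSp d) 2 P →L[ℝ] F :=
  A.comp (.fst ℝ _ _) + (pairL2 P a).comp (.snd ℝ _ _)

theorem stateForm_apply (A : RSp d →L[ℝ] F) (a : Ω → RSp d →L[ℝ] F)
    (ζ : RSp d × Lp (RSp d) 2 P) : stateForm P A a ζ = A ζ.1 + pairL2 P a ζ.2 := rfl

theorem stateForm_sub (A B : RSp d →L[ℝ] F) {a b : Ω → RSp d →L[ℝ] F} (ha : MemLp a 2 P)
    (hb : MemLp b 2 P) :
    stateForm P (A - B) (fun ω => a ω - b ω) = stateForm P A a - stateForm P B b := by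
  rw [stateForm, stateForm, stateForm, pairL2_sub ha hb, ContinuousLinearMap.sub_comp,
    ContinuousLinearMap.sub_comp]
  abel

theorem stateForm_comp_left (A : RSp d →L[ℝ] F) {a : Ω → RSp d →L[ℝ] F} (ha : MemLp a 2 P)
    (T : F →L[ℝ] G) :
    stateForm P (T.comp A) (fun ω => T.comp (a ω)) = T.comp (stateForm P A a) := by
  rw [stateForm, stateForm, pairL2_comp_left ha, ContinuousLinearMap.comp_add]
  rfl

theorem norm_stateForm_le_add (A : RSp d →L[ℝ] F) (a : Ω → RSp d →L[ℝ] F) :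
    ‖stateForm P A a‖ ≤ ‖A‖ + ‖pairL2 P a‖ := by
  refine ContinuousLinearMap.opNorm_le_bound _ (by positivity) fun ζ => ?_
  rw [stateForm_apply, add_mul]
  refine (norm_add_le _ _).trans ?_
  gcongr
  · exact (A.le_opNorm _).trans (by gcongr; exact norm_fst_le ζ)
  · exact ((pairL2 P a).le_opNorm _).trans (by gcongr; exact norm_snd_le ζ)

theorem norm_stateForm_le [IsProbabilityMeasure P] {A : RSp d →L[ℝ] F} {a : Ω → RSp d →L[ℝ] F}
    {C : ℝ} (hA : ‖A‖ ≤ C) (ha : ∀ ω, ‖a ω‖ ≤ C) : ‖stateForm P A a‖ ≤ 2 * C := by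
  have := norm_stateForm_le_add (P := P) A a
  have h2 := norm_pairL2_le_const (P := P) ((norm_nonneg _).trans hA) ha
  linarith

end StateForm

/-! ### Lifts of functions differentiable once in `x` and `μ` -/

section LiftDeriv

variable {Ω : Type*} [MeasurableSpace Ω] {P : Measure Ω} [IsProbabilityMeasure P] {d : ℕ}
  {F G : Type*} [NormedAddCommGroup F] [NormedSpace ℝ F] [CompleteSpace F]
  [NormedAddCommGroup G] [NormedSpace ℝ G] [CompleteSpace G]

/-- `g(x, μ)` is differentiable in `x` and in `μ`, with derivatives bounded by `K` and
`L`-Lipschitz in all space variables. -/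
structure LiftC1 (K L : ℝ) (g : RSp d → P2 d → F) (dx : RSp d → P2 d → (RSp d →L[ℝ] F))
    (dm : RSp d → P2 d → RSp d → (RSp d →L[ℝ] F)) : Prop where
  hasFDerivAt : ∀ x μ, HasFDerivAt (fun y => g y μ) (dx x μ) x
  hasLDeriv : ∀ x, HasLDeriv (g x) (dm x)
  bound_x : ∀ x μ, ‖dx x μ‖ ≤ K
  bound_m : ∀ x μ v, ‖dm x μ v‖ ≤ K
  lip_x : ∀ x μ y ν, ‖dx x μ - dx y ν‖ ≤ L * (‖x - y‖ + wass2 μ ν)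
  lip_m : ∀ x μ v y ν w, ‖dm x μ v - dm y ν w‖ ≤ L * (‖x - y‖ + wass2 μ ν + ‖v - w‖)

/-- The derivative of the lift `(x, X) ↦ g(x, Law X)`, in terms of the derivatives of `g`. -/
def liftDeriv (P : Measure Ω) [IsProbabilityMeasure P] (dx : RSp d → P2 d → (RSp d →L[ℝ] F))
    (dm : RSp d → P2 d → RSp d → (RSp d →L[ℝ] F)) (z : RSp d × Lp (RSp d) 2 P) :
    RSp d × Lp (RSp d) 2 P →L[ℝ] F :=
  stateForm P (dx z.1 (lawL2 P z.2)) (fun ω => dm z.1 (lawL2 P z.2) (z.2 ω))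

variable {K L : ℝ} {g : RSp d → P2 d → F} {dx : RSp d → P2 d → (RSp d →L[ℝ] F)}
  {dm : RSp d → P2 d → RSp d → (RSp d →L[ℝ] F)}

theorem wass2_lawL2_snd_le (z z' : RSp d × Lp (RSp d) 2 P) :
    wass2 (lawL2 P z.2) (lawL2 P z'.2) ≤ ‖z - z'‖ :=
  (wass2_lawL2_le _ _).trans (norm_snd_le (z - z'))

theorem norm_fst_sub_le {A B : Type*} [SeminormedAddCommGroup A] [SeminormedAddCommGroup B]
    (z z' : A × B) : ‖z.1 - z'.1‖ ≤ ‖z - z'‖ := norm_fst_le (z - z')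

theorem norm_snd_sub_le {A B : Type*} [SeminormedAddCommGroup A] [SeminormedAddCommGroup B]
    (z z' : A × B) : ‖z.2 - z'.2‖ ≤ ‖z - z'‖ := norm_snd_le (z - z')

theorem norm_liftDeriv_le (h₁ : ∀ x μ, ‖dx x μ‖ ≤ K) (h₂ : ∀ x μ v, ‖dm x μ v‖ ≤ K)
    (z : RSp d × Lp (RSp d) 2 P) : ‖liftDeriv P dx dm z‖ ≤ 2 * K :=
  norm_stateForm_le (h₁ _ _) fun _ => h₂ _ _ _

theorem LiftC1.memLp (h : LiftC1 K L g dx dm) (z : RSp d × Lp (RSp d) 2 P) :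
    MemLp (fun ω => dm z.1 (lawL2 P z.2) (z.2 ω)) 2 P :=
  (h.hasLDeriv z.1).memLp_comp z.2

/-- Comparison of two lifted derivatives at different points. -/
theorem norm_liftDeriv_sub_le {g' : RSp d → P2 d → F} {dx' : RSp d → P2 d → (RSp d →L[ℝ] F)}
    {dm' : RSp d → P2 d → RSp d → (RSp d →L[ℝ] F)} {K' L' M c : ℝ} (hM : 0 ≤ M) (hc : 0 ≤ c)
    (h : LiftC1 K L g dx dm) (h' : LiftC1 K' L' g' dx' dm')
    (hx : ∀ x μ y ν, ‖dx x μ - dx' y ν‖ ≤ M * (‖x - y‖ + wass2 μ ν + c))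
    (hm : ∀ x μ v y ν w, ‖dm x μ v - dm' y ν w‖ ≤ M * (‖x - y‖ + wass2 μ ν + ‖v - w‖ + c))
    (z z' : RSp d × Lp (RSp d) 2 P) :
    ‖liftDeriv P dx dm z - liftDeriv P dx' dm' z'‖ ≤ 5 * M * (‖z - z'‖ + c) := by
  rw [liftDeriv, liftDeriv, ← stateForm_sub _ _ (h.memLp z) (h'.memLp z')]
  refine (norm_stateForm_le_add _ _).trans ?_
  have h1 : ‖dx z.1 (lawL2 P z.2) - dx' z'.1 (lawL2 P z'.2)‖ ≤ M * (2 * ‖z - z'‖ + c) := by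
    refine (hx _ _ _ _).trans ?_
    gcongr
    linarith [wass2_lawL2_snd_le z z', norm_fst_sub_le z z']
  have h2 : ‖pairL2 P (fun ω => dm z.1 (lawL2 P z.2) (z.2 ω) - dm' z'.1 (lawL2 P z'.2) (z'.2 ω))‖
      ≤ M * ((2 * ‖z - z'‖ + c) + ‖z.2 - z'.2‖) := by
    refine norm_pairL2_le_affine hM (by positivity) (z.2 - z'.2) ?_
    filter_upwards [Lp.coeFn_sub z.2 z'.2] with ω hω
    refine (hm _ _ _ _ _ _).trans (mul_le_mul_of_nonneg_left ?_ hM)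
    rw [hω, Pi.sub_apply]
    linarith [wass2_lawL2_snd_le z z', norm_fst_sub_le z z']
  have h3 : M * ‖z.2 - z'.2‖ ≤ M * ‖z - z'‖ := by gcongr; exact norm_snd_sub_le z z'
  have h4 : 0 ≤ M * c := by positivity
  -- With `r = ‖z - z'‖` the two parts give `M(2r + c) + M(3r + c) ≤ 5M(r + c)`.
  nlinarith

theorem LiftC1.norm_liftDeriv_sub_le (h : LiftC1 K L g dx dm) (hL : 0 ≤ L)
    (z z' : RSp d × Lp (RSp d) 2 P) :
    ‖liftDeriv P dx dm z - liftDeriv P dx dm z'‖ ≤ 5 * L * ‖z - z'‖ := by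
  have := _root_.norm_liftDeriv_sub_le hL le_rfl h h (fun x μ y ν => by simpa using h.lip_x x μ y ν)
    (fun x μ v y ν w => by simpa using h.lip_m x μ v y ν w) z z'
  simpa using this

theorem norm_image_sub_le_of_bound {E : Type*} [NormedAddCommGroup E] [NormedSpace ℝ E]
    {F : Type*} [NormedAddCommGroup F] [NormedSpace ℝ F] {K : ℝ} {g : E → F} {g' : E → E →L[ℝ] F} (h : ∀ x, HasFDerivAt g (g' x) x) (hK : ∀ x, ‖g' x‖ ≤ K)
    (x y : E) : ‖g x - g y‖ ≤ K * ‖x - y‖ :=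
  convex_univ.norm_image_sub_le_of_norm_hasFDerivWithin_le
    (fun z _ => (h z).hasFDerivWithinAt) (fun z _ => hK z) (mem_univ y) (mem_univ x)

/-- Moves first `x`, then `μ`. It supplies the Lipschitz bounds on `D_x f` and `∂_μ f`, which are
not assumed but follow from bounded second derivatives. -/
theorem LiftC1.norm_sub_le (h : LiftC1 K L g dx dm) (x : RSp d) (μ : P2 d) (y : RSp d) (ν : P2 d) :
    ‖g x μ - g y ν‖ ≤ K * (‖x - y‖ + wass2 μ ν) := by
  have h1 := norm_image_sub_le_of_bound (fun x => h.hasFDerivAt x μ) (fun x => h.bound_x x μ) x y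
  have h2 := (h.hasLDeriv y).norm_sub_le (h.bound_m y) μ ν
  have h3 := norm_sub_le_norm_sub_add_norm_sub (g x μ) (g y μ) (g y ν)
  linarith

/-- First-order expansion of the lift. -/
theorem LiftC1.norm_expansion_le (h : LiftC1 K L g dx dm) (hL : 0 ≤ L)
    (z ζ : RSp d × Lp (RSp d) 2 P) :
    ‖g (z + ζ).1 (lawL2 P (z + ζ).2) - g z.1 (lawL2 P z.2) - liftDeriv P dx dm z ζ‖
      ≤ 4 * L * ‖ζ‖ ^ 2 := by
  obtain ⟨x, X⟩ := z
  obtain ⟨k, H⟩ := ζ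
  set r := ‖(k, H)‖
  have hk : ‖k‖ ≤ r := norm_fst_le (k, H)
  have hH : ‖H‖ ≤ r := norm_snd_le (k, H)
  have hr : 0 ≤ r := norm_nonneg _
  set μ := lawL2 P X
  set ν := lawL2 P (X + H) with hν
  have hνμ : wass2 ν μ ≤ r := by
    have := wass2_lawL2_le (X + H) X
    rw [add_sub_cancel_left] at this
    exact this.trans hH
  have hL1 : L * ‖k‖ ≤ L * r := by gcongr
  have h1 : ‖g (x + k) ν - g x ν - dx x ν k‖ ≤ L * r * r := by
    have := (convex_segment x (x + k)).norm_image_sub_le_of_norm_hasFDerivWithin_le'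
      (f := fun y => g y ν) (f' := fun y => dx y ν) (C := L * r) (φ := dx x ν)
      (fun y _ => (h.hasFDerivAt y ν).hasFDerivWithinAt) (fun y hy => ?_)
      (left_mem_segment ℝ x (x + k)) (right_mem_segment ℝ x (x + k))
    · rw [add_sub_cancel_left] at this
      exact this.trans (by gcongr)
    · refine (h.lip_x _ _ _ _).trans ?_
      rw [hν, wass2_lawL2_self, add_zero]
      gcongr
      have := norm_sub_le_of_mem_segment hy
      rw [add_sub_cancel_left] at this
      exact this.trans hk
  have h2 : ‖dx x ν k - dx x μ k‖ ≤ L * r * r := by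
    rw [← sub_apply]
    refine (ContinuousLinearMap.le_opNorm _ _).trans ?_
    gcongr
    refine (h.lip_x _ _ _ _).trans ?_
    simpa using by gcongr
  have h3 := (h.hasLDeriv x).norm_expansion_le hL
    (fun μ ν v w => by simpa using h.lip_m x μ v x ν w) X H
  have h4 : 2 * L * ‖H‖ ^ 2 ≤ 2 * L * r ^ 2 := by gcongr
  -- Three moves: `x` at the new law, the law inside `D_x g`, then the law at the old `x`. Their
  -- errors `L r²`, `L r²` and `2 L r²` add up to the constant 4.
  have h5 : g (x + k) ν - g x μ - liftDeriv P dx dm (x, X) (k, H)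
      = (g (x + k) ν - g x ν - dx x ν k) + (dx x ν k - dx x μ k)
        + (g x ν - g x μ - pairL2 P (fun ω => dm x μ (X ω)) H) := by
    rw [liftDeriv, stateForm_apply]
    abel
  change ‖g (x + k) ν - g x μ - liftDeriv P dx dm (x, X) (k, H)‖ ≤ _
  rw [h5]
  refine norm_add₃_le.trans ?_
  nlinarith

end LiftDeriv

/-! ### Hölder's inequality for three functions -/

section ThreeHolder

variable {Ω : Type*} [MeasurableSpace Ω] {P : Measure Ω} [IsProbabilityMeasure P]
  {A : Type*} [NormedAddCommGroup A] {p : ℝ≥0} [Fact (1 ≤ (p : ℝ≥0∞))] {θ : ℝ}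

/-- Hölder's inequality in `L_q`, `q = 2 + θ`, with weights `θ/q + 1/q + 1/q = 1`, then `L_p ⊆ L_q`
on a probability space. This is where integrability beyond order 2 is spent. -/
theorem lintegral_rpow_mul_mul_le (hθ : 0 ≤ θ) (hp : 2 + θ ≤ p) (K H₁ H₂ : Lp A p P) :
    ∫⁻ ω, ‖K ω‖ₑ ^ θ * ‖H₁ ω‖ₑ * ‖H₂ ω‖ₑ ∂P ≤ ‖K‖ₑ ^ θ * ‖H₁‖ₑ * ‖H₂‖ₑ := by
  set q : ℝ := 2 + θ with hq
  have hq0 : 0 < q := by positivity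
  have hqp : ENNReal.ofReal q ≤ p := by
    rw [← ENNReal.ofReal_coe_nnreal]; exact ENNReal.ofReal_le_ofReal hp
  have hbase : ∀ X : Lp A p P, (∫⁻ ω, ‖X ω‖ₑ ^ q ∂P) ^ (1 / q) ≤ ‖X‖ₑ := fun X => by
    have := eLpNorm_le_eLpNorm_of_exponent_le hqp (Lp.aestronglyMeasurable X)
    rw [eLpNorm_eq_lintegral_rpow_enorm_toReal (by simpa using hq0) (by simp),
      ENNReal.toReal_ofReal hq0.le] at this
    rwa [Lp.enorm_def]
  have hmeas : ∀ X : Lp A p P, AEMeasurable (fun ω => ‖X ω‖ₑ ^ q) P := fun X =>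
    (Lp.aestronglyMeasurable X).enorm.pow_const q
  have hcancel : ∀ (a : ℝ≥0∞) (s : ℝ), (a ^ q) ^ (s / q) = a ^ s := fun a s => by
    rw [← ENNReal.rpow_mul]; congr 1; field_simp
  have hcancel' : ∀ (a : ℝ≥0∞) (s : ℝ), a ^ (s / q) = (a ^ (1 / q)) ^ s := fun a s => by
    rw [← ENNReal.rpow_mul]; congr 1; field_simp
  have key := ENNReal.lintegral_prod_norm_pow_le (μ := P) (Finset.univ : Finset (Fin 3))
    (f := ![fun ω => ‖K ω‖ₑ ^ q, fun ω => ‖H₁ ω‖ₑ ^ q, fun ω => ‖H₂ ω‖ₑ ^ q])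
    (p := ![θ / q, 1 / q, 1 / q])
    (by intro i _; fin_cases i <;> exact hmeas _)
    (by simp [Fin.sum_univ_three]; field_simp; rw [hq]; ring)
    (by intro i _; fin_cases i <;> simp <;> positivity)
  simp only [Fin.prod_univ_three] at key
  change ∫⁻ ω, (‖K ω‖ₑ ^ q) ^ (θ / q) * (‖H₁ ω‖ₑ ^ q) ^ (1 / q) * (‖H₂ ω‖ₑ ^ q) ^ (1 / q) ∂P
    ≤ (∫⁻ ω, ‖K ω‖ₑ ^ q ∂P) ^ (θ / q) * (∫⁻ ω, ‖H₁ ω‖ₑ ^ q ∂P) ^ (1 / q)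
      * (∫⁻ ω, ‖H₂ ω‖ₑ ^ q ∂P) ^ (1 / q) at key
  simp only [hcancel, ENNReal.rpow_one] at key
  refine key.trans ?_
  rw [hcancel' _ θ]
  gcongr <;> exact hbase _

/-- The case `θ = 0` is Cauchy–Schwarz in a format matching the case `θ > 0`; integrability is
recorded because these products serve as majorants. -/
theorem integral_rpow_mul_mul_le (hθ : 0 ≤ θ) (hp : 2 + θ ≤ p) (K H₁ H₂ : Lp A p P) :
    Integrable (fun ω => ‖K ω‖ ^ θ * ‖H₁ ω‖ * ‖H₂ ω‖) P ∧
      ∫ ω, ‖K ω‖ ^ θ * ‖H₁ ω‖ * ‖H₂ ω‖ ∂P ≤ ‖K‖ ^ θ * ‖H₁‖ * ‖H₂‖ := by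
  have hconv : ∀ a b c : A,
      ENNReal.ofReal (‖a‖ ^ θ * ‖b‖ * ‖c‖) = ‖a‖ₑ ^ θ * ‖b‖ₑ * ‖c‖ₑ := fun a b c => by
    rw [ENNReal.ofReal_mul (by positivity), ENNReal.ofReal_mul (by positivity),
      ← ENNReal.ofReal_rpow_of_nonneg (norm_nonneg _) hθ, ofReal_norm, ofReal_norm, ofReal_norm]
  have hnn : ∀ ω, 0 ≤ ‖K ω‖ ^ θ * ‖H₁ ω‖ * ‖H₂ ω‖ := fun ω => by positivity
  have hm : AEStronglyMeasurable (fun ω => ‖K ω‖ ^ θ * ‖H₁ ω‖ * ‖H₂ ω‖) P :=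
    ((((Lp.aestronglyMeasurable K).norm.aemeasurable.pow_const θ).aestronglyMeasurable).mul
      (Lp.aestronglyMeasurable H₁).norm).mul (Lp.aestronglyMeasurable H₂).norm
  have hle : ∫⁻ ω, ENNReal.ofReal (‖K ω‖ ^ θ * ‖H₁ ω‖ * ‖H₂ ω‖) ∂P
      ≤ ENNReal.ofReal (‖K‖ ^ θ * ‖H₁‖ * ‖H₂‖) := by
    simp_rw [hconv]
    rw [ENNReal.ofReal_mul (by positivity), ENNReal.ofReal_mul (by positivity),
      ← ENNReal.ofReal_rpow_of_nonneg (norm_nonneg _) hθ, ofReal_norm, ofReal_norm, ofReal_norm]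
    exact lintegral_rpow_mul_mul_le hθ hp K H₁ H₂
  constructor
  · refine ⟨hm, ?_⟩
    rw [hasFiniteIntegral_iff_ofReal (.of_forall hnn)]
    exact hle.trans_lt ENNReal.ofReal_lt_top
  · rw [integral_eq_lintegral_of_nonneg_ae (.of_forall hnn) hm]
    exact ENNReal.toReal_le_of_le_ofReal (by positivity) hle

theorem integral_norm_lp_le (H : Lp A p P) :
    Integrable (fun ω => ‖H ω‖) P ∧ ∫ ω, ‖H ω‖ ∂P ≤ ‖H‖ := by
  have h1 : MemLp H 1 P := (Lp.memLp H).mono_exponent Fact.out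
  refine ⟨(memLp_one_iff_integrable.1 h1).norm, ?_⟩
  rw [integral_norm_eq_lintegral_enorm h1.1, ← eLpNorm_one_eq_lintegral_enorm, Lp.norm_def]
  exact ENNReal.toReal_mono (Lp.eLpNorm_ne_top H)
    (eLpNorm_le_eLpNorm_of_exponent_le Fact.out h1.1)

end ThreeHolder

/-! ### Second-order forms on the state space -/

section MulPair

variable {Ω : Type*} [MeasurableSpace Ω] {P : Measure Ω}
  {U F : Type*} [NormedAddCommGroup U] [NormedSpace ℝ U]
  [NormedAddCommGroup F] [NormedSpace ℝ F] [CompleteSpace F]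

open Classical in
/-- The bilinear form `(K, H) ↦ ∫ B(ω)(K(ω), H(ω)) dP(ω)` on `L₂`, for an essentially bounded
`B` (and `0` if `B` is not essentially bounded). -/
def mulPair (P : Measure Ω) (B : Ω → U →L[ℝ] U →L[ℝ] F) : Lp U 2 P →L[ℝ] Lp U 2 P →L[ℝ] F :=
  if h : MemLp B ∞ P then
    ((ContinuousLinearMap.id ℝ (U →L[ℝ] F)).lpPairing P 2 2).comp
      ((ContinuousLinearMap.id ℝ (U →L[ℝ] U →L[ℝ] F)).holderL P ∞ 2 2 (h.toLp B))
  else 0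

theorem memLp_apply_of_memLp_top {G : Type*} [NormedAddCommGroup G] [NormedSpace ℝ G]
    {B : Ω → U →L[ℝ] G} (h : MemLp B ∞ P) (K : Lp U 2 P) : MemLp (fun ω => B ω (K ω)) 2 P :=
  (ContinuousLinearMap.id ℝ (U →L[ℝ] G)).memLp_of_bilin (p := ∞) (q := 2) 2 h (Lp.memLp K)

theorem mulPair_apply {B : Ω → U →L[ℝ] U →L[ℝ] F} (h : MemLp B ∞ P) (K : Lp U 2 P) :
    mulPair P B K = pairL2 P (fun ω => B ω (K ω)) := by
  ext H
  rw [pairL2_apply (memLp_apply_of_memLp_top h K), mulPair, dif_pos h,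
    ContinuousLinearMap.comp_apply, ContinuousLinearMap.lpPairing_eq_integral]
  refine integral_congr_ae ?_
  filter_upwards [ContinuousLinearMap.coeFn_holder (𝕜 := ℝ) (E := U →L[ℝ] U →L[ℝ] F) (F := U)
      (G := U →L[ℝ] F) (r := 2) (.id ℝ (U →L[ℝ] U →L[ℝ] F)) (h.toLp B) K, MemLp.coeFn_toLp (E := U →L[ℝ] U →L[ℝ] F) h] with ω h1 h2
  rw [ContinuousLinearMap.holderL_apply_apply, h1, h2]
  rfl

/-- Needed for increments of `B` that are not small in `L_∞`: the integrand must survive until it is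
tested against `L_p` directions. -/
theorem norm_mulPair_apply_le (B : Ω → U →L[ℝ] U →L[ℝ] F) (K H : Lp U 2 P) :
    ‖mulPair P B K H‖ ≤ ∫ ω, ‖B ω (K ω)‖ * ‖H ω‖ ∂P := by
  by_cases h : MemLp B ∞ P
  · rw [mulPair_apply h]
    exact norm_pairL2_apply_le _ H
  · rw [mulPair, dif_neg h]
    simpa using integral_nonneg fun ω => by positivity

theorem mulPair_sub {B B' : Ω → U →L[ℝ] U →L[ℝ] F} (h : MemLp B ∞ P) (h' : MemLp B' ∞ P) :
    mulPair P (fun ω => B ω - B' ω) = mulPair P B - mulPair P B' := by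
  ext1 K
  have hs : MemLp (fun ω => B ω - B' ω) ∞ P :=
    MemLp.sub (E := U →L[ℝ] U →L[ℝ] F) h h'
  rw [sub_apply, mulPair_apply hs, mulPair_apply h, mulPair_apply h',
    ← pairL2_sub (memLp_apply_of_memLp_top h K) (memLp_apply_of_memLp_top h' K)]
  rfl

theorem norm_mulPair_le [IsProbabilityMeasure P] {B : Ω → U →L[ℝ] U →L[ℝ] F} {C : ℝ} (hC : 0 ≤ C)
    (hB : ∀ ω, ‖B ω‖ ≤ C) : ‖mulPair P B‖ ≤ C := by
  refine ContinuousLinearMap.opNorm_le_bound _ hC fun K => ?_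
  by_cases h : MemLp B ∞ P
  · rw [mulPair_apply h]
    have := norm_pairL2_le_affine (P := P) (a := fun ω => B ω (K ω)) hC le_rfl K
      (.of_forall fun ω => by
        rw [zero_add]; exact (B ω).le_of_opNorm_le (hB ω) _)
    simpa using this
  · rw [mulPair, dif_neg h]
    simp; positivity

theorem memLp_flip {E : Type*} [NormedAddCommGroup E] [NormedSpace ℝ E]
    {A : Ω → E →L[ℝ] U →L[ℝ] F} (h : MemLp A 2 P) : MemLp (fun ω => (A ω).flip) 2 P :=
  MemLp.congr_norm (E := E →L[ℝ] U →L[ℝ] F) (F := U →L[ℝ] E →L[ℝ] F) h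
    ((ContinuousLinearMap.flipₗᵢ ℝ E U F).continuous.comp_aestronglyMeasurable h.1)
    (.of_forall fun ω => ((A ω).opNorm_flip).symm)

theorem pairL2_flip_apply {E : Type*} [NormedAddCommGroup E] [NormedSpace ℝ E]
    {A : Ω → E →L[ℝ] U →L[ℝ] F} (h : MemLp A 2 P) (ζ : E) :
    (pairL2 P (fun ω => (A ω).flip)).flip ζ = pairL2 P (fun ω => A ω ζ) := by
  rw [show (fun ω => A ω ζ) = fun ω => (ContinuousLinearMap.apply ℝ F ζ).comp (A ω).flip from rfl,
    pairL2_comp_left (memLp_flip h)]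
  rfl

end MulPair

/-! ### The second-order form on the product space -/

section StateForm₂

variable {Ω : Type*} [MeasurableSpace Ω] {P : Measure Ω} {d : ℕ}
  {F : Type*} [NormedAddCommGroup F] [NormedSpace ℝ F] [CompleteSpace F]

/-- The bilinear form `(ζ, η) ↦ A(ζ, η₁) + 𝔼[a(ζ, η₂)] + 𝔼[B(ζ₂, η₂)]` on `ℝ^d × L₂`. -/
def stateForm₂ (P : Measure Ω) (A : RSp d × Lp (RSp d) 2 P →L[ℝ] RSp d →L[ℝ] F)
    (a : Ω → RSp d × Lp (RSp d) 2 P →L[ℝ] RSp d →L[ℝ] F)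
    (B : Ω → RSp d →L[ℝ] RSp d →L[ℝ] F) :
    RSp d × Lp (RSp d) 2 P →L[ℝ] RSp d × Lp (RSp d) 2 P →L[ℝ] F :=
  ((ContinuousLinearMap.compL ℝ _ (RSp d) F).flip (.fst ℝ _ _)).comp A
    + ((ContinuousLinearMap.compL ℝ _ (Lp (RSp d) 2 P) F).flip (.snd ℝ _ _)).comp
      ((pairL2 P (fun ω => (a ω).flip)).flip + (mulPair P B).comp (.snd ℝ _ _))

theorem stateForm₂_apply (A : RSp d × Lp (RSp d) 2 P →L[ℝ] RSp d →L[ℝ] F)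
    (a : Ω → RSp d × Lp (RSp d) 2 P →L[ℝ] RSp d →L[ℝ] F)
    (B : Ω → RSp d →L[ℝ] RSp d →L[ℝ] F) (ζ η : RSp d × Lp (RSp d) 2 P) :
    stateForm₂ P A a B ζ η
      = A ζ η.1 + (pairL2 P (fun ω => (a ω).flip) η.2 ζ + mulPair P B ζ.2 η.2) := rfl

/-- Only the `B` part is left unestimated: the others are controlled in operator norm on `L₂`,
whereas `B` needs the finer three-function Hölder bound. -/
theorem norm_stateForm₂_apply_le (A : RSp d × Lp (RSp d) 2 P →L[ℝ] RSp d →L[ℝ] F)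
    (a : Ω → RSp d × Lp (RSp d) 2 P →L[ℝ] RSp d →L[ℝ] F)
    (B : Ω → RSp d →L[ℝ] RSp d →L[ℝ] F) (ζ η : RSp d × Lp (RSp d) 2 P) :
    ‖stateForm₂ P A a B ζ η‖ ≤ (‖A‖ + ‖pairL2 P (fun ω => (a ω).flip)‖) * ‖ζ‖ * ‖η‖
      + ‖mulPair P B ζ.2 η.2‖ := by
  rw [stateForm₂_apply]
  have h1 : ‖A ζ η.1‖ ≤ ‖A‖ * ‖ζ‖ * ‖η‖ := (A.le_opNorm₂ _ _).trans (by
    gcongr; exact norm_fst_le η)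
  have h2 : ‖pairL2 P (fun ω => (a ω).flip) η.2 ζ‖
      ≤ ‖pairL2 P (fun ω => (a ω).flip)‖ * ‖η‖ * ‖ζ‖ :=
    ((pairL2 P (fun ω => (a ω).flip)).le_opNorm₂ _ _).trans (by gcongr; exact norm_snd_le η)
  have h3 := norm_add_le (A ζ η.1) (pairL2 P (fun ω => (a ω).flip) η.2 ζ + mulPair P B ζ.2 η.2)
  have h4 := norm_add_le (pairL2 P (fun ω => (a ω).flip) η.2 ζ) (mulPair P B ζ.2 η.2)
  nlinarith

theorem norm_stateForm₂_le (A : RSp d × Lp (RSp d) 2 P →L[ℝ] RSp d →L[ℝ] F)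
    (a : Ω → RSp d × Lp (RSp d) 2 P →L[ℝ] RSp d →L[ℝ] F)
    (B : Ω → RSp d →L[ℝ] RSp d →L[ℝ] F) :
    ‖stateForm₂ P A a B‖ ≤ ‖A‖ + ‖pairL2 P (fun ω => (a ω).flip)‖ + ‖mulPair P B‖ := by
  refine ContinuousLinearMap.opNorm_le_bound₂ _ (by positivity) fun ζ η => ?_
  refine (norm_stateForm₂_apply_le A a B ζ η).trans ?_
  have : ‖mulPair P B ζ.2 η.2‖ ≤ ‖mulPair P B‖ * ‖ζ‖ * ‖η‖ :=
    ((mulPair P B).le_opNorm₂ _ _).trans (by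
      gcongr
      · exact norm_snd_le ζ
      · exact norm_snd_le η)
  linarith

theorem stateForm₂_sub (A A' : RSp d × Lp (RSp d) 2 P →L[ℝ] RSp d →L[ℝ] F)
    {a a' : Ω → RSp d × Lp (RSp d) 2 P →L[ℝ] RSp d →L[ℝ] F}
    {B B' : Ω → RSp d →L[ℝ] RSp d →L[ℝ] F} (ha : MemLp a 2 P) (ha' : MemLp a' 2 P)
    (hB : MemLp B ∞ P) (hB' : MemLp B' ∞ P) :
    stateForm₂ P (A - A') (fun ω => a ω - a' ω) (fun ω => B ω - B' ω)
      = stateForm₂ P A a B - stateForm₂ P A' a' B' := by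
  refine ContinuousLinearMap.ext fun ζ => ContinuousLinearMap.ext fun η => ?_
  rw [sub_apply, sub_apply, stateForm₂_apply, stateForm₂_apply, stateForm₂_apply,
    mulPair_sub hB hB', show (fun ω => (a ω - a' ω).flip) = fun ω => (a ω).flip - (a' ω).flip
      from rfl, pairL2_sub (memLp_flip ha) (memLp_flip ha')]
  simp only [sub_apply]
  abel

end StateForm₂

/-! ### Second derivative of the lift of a coefficient -/

section Interpolation

/-- Interpolation between a bound and a Lipschitz estimate: the Lipschitz one wins for `r ≤ 1`, the
bound for `r ≥ 1`. -/
theorem le_mul_rpow_of_le_of_le_mul {a A B r θ : ℝ} (hr : 0 ≤ r) (hθ : 0 < θ)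
    (hθ1 : θ ≤ 1) (hB : 0 ≤ B) (h₁ : a ≤ A) (h₂ : a ≤ B * r) : a ≤ max A B * r ^ θ := by
  have hM : 0 ≤ max A B := hB.trans (le_max_right _ _)
  rcases le_total r 1 with h | h
  · calc a ≤ B * r := h₂
      _ ≤ max A B * r ^ θ := by
        gcongr
        · exact le_max_right _ _
        · simpa using Real.rpow_le_rpow_of_exponent_ge' hr h hθ.le hθ1
  · calc a ≤ A := h₁
      _ ≤ max A B * 1 := by simp
      _ ≤ max A B * r ^ θ := by gcongr; exact Real.one_le_rpow h hθ.le

theorem le_mul_rpow_add_rpow_of_le {a A B r s θ : ℝ} (hr : 0 ≤ r) (hs : 0 ≤ s) (hθ : 0 < θ)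
    (hθ1 : θ ≤ 1) (hB : 0 ≤ B) (h₁ : a ≤ A) (h₂ : a ≤ B * (r + s)) :
    a ≤ max A (2 * B) * (r ^ θ + s ^ θ) := by
  have hM : 0 ≤ max A (2 * B) := (by positivity : 0 ≤ 2 * B).trans (le_max_right _ _)
  have key : a ≤ max A (2 * B) * (max r s) ^ θ := by
    refine le_mul_rpow_of_le_of_le_mul (hr.trans (le_max_left _ _)) hθ hθ1 (by positivity) h₁ ?_
    nlinarith [le_max_left r s, le_max_right r s]
  refine key.trans ?_
  gcongr
  rcases le_total r s with h | h
  · rw [max_eq_right h]; linarith [Real.rpow_nonneg hr θ]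
  · rw [max_eq_left h]; linarith [Real.rpow_nonneg hs θ]

end Interpolation

/-- A function of `(x, μ)` together with candidates for its derivatives up to order two. -/
structure LiftJet (d : ℕ) (F : Type*) [NormedAddCommGroup F] [NormedSpace ℝ F] where
  /-- the function -/
  fn : RSp d → P2 d → F
  /-- `D_x` -/
  dx : RSp d → P2 d → (RSp d →L[ℝ] F)
  /-- `∂_μ` -/
  dm : RSp d → P2 d → RSp d → (RSp d →L[ℝ] F)
  /-- `D_x²` -/
  dxx : RSp d → P2 d → (RSp d →L[ℝ] RSp d →L[ℝ] F)
  /-- `∂_μ D_x` -/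
  dxm : RSp d → P2 d → RSp d → (RSp d →L[ℝ] RSp d →L[ℝ] F)
  /-- `D_x ∂_μ` -/
  dmx : RSp d → P2 d → RSp d → (RSp d →L[ℝ] RSp d →L[ℝ] F)
  /-- `∂_μ²` -/
  dmm : RSp d → P2 d → RSp d → RSp d → (RSp d →L[ℝ] RSp d →L[ℝ] F)
  /-- `D_v ∂_μ` -/
  dv : RSp d → P2 d → RSp d → (RSp d →L[ℝ] RSp d →L[ℝ] F)

section LiftC2

variable {Ω : Type*} [MeasurableSpace Ω] {P : Measure Ω} [IsProbabilityMeasure P] {d : ℕ}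
  {F : Type*} [NormedAddCommGroup F] [NormedSpace ℝ F] [CompleteSpace F]

/-- The entries of the jet are indeed derivatives of its function; they are bounded by `K` and
`L`-Lipschitz. -/
structure LiftC2 (K L : ℝ) (J : LiftJet d F) : Prop where
  first : LiftC1 K L J.fn J.dx J.dm
  deriv_x : LiftC1 K L J.dx J.dxx J.dxm
  deriv_m : ∀ v, LiftC1 K L (fun x μ => J.dm x μ v) (fun x μ => J.dmx x μ v)
    (fun x μ => J.dmm x μ v)
  hasFDerivAt_v : ∀ x μ v, HasFDerivAt (J.dm x μ) (J.dv x μ v) v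
  bound_v : ∀ x μ v, ‖J.dv x μ v‖ ≤ K
  lip_v : ∀ x μ v y ν w, ‖J.dv x μ v - J.dv y ν w‖ ≤ L * (‖x - y‖ + wass2 μ ν + ‖v - w‖)
  lip_mx : ∀ x μ v y ν w, ‖J.dmx x μ v - J.dmx y ν w‖ ≤ L * (‖x - y‖ + wass2 μ ν + ‖v - w‖)
  lip_mm : ∀ x μ v v₂ y ν w w₂, ‖J.dmm x μ v v₂ - J.dmm y ν w w₂‖
    ≤ L * (‖x - y‖ + wass2 μ ν + ‖v - w‖ + ‖v₂ - w₂‖)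

/-- The derivative of `(x, X) ↦ ∂_μ f(x, Law X)(v)` for fixed `v`. -/
def LiftJet.derivDm (P : Measure Ω) [IsProbabilityMeasure P] (J : LiftJet d F) (v : RSp d)
    (z : RSp d × Lp (RSp d) 2 P) : RSp d × Lp (RSp d) 2 P →L[ℝ] RSp d →L[ℝ] F :=
  liftDeriv P (fun x μ => J.dmx x μ v) (fun x μ => J.dmm x μ v) z

/-- The second derivative of the lift, in terms of the entries of the jet. -/
def LiftJet.liftDeriv₂ (P : Measure Ω) [IsProbabilityMeasure P] (J : LiftJet d F)
    (z : RSp d × Lp (RSp d) 2 P) :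
    RSp d × Lp (RSp d) 2 P →L[ℝ] RSp d × Lp (RSp d) 2 P →L[ℝ] F :=
  stateForm₂ P (liftDeriv P J.dxx J.dxm z) (fun ω => J.derivDm P (z.2 ω) z)
    (fun ω => J.dv z.1 (lawL2 P z.2) (z.2 ω))

variable {K L : ℝ} {J : LiftJet d F}

/-- For fixed `v` and `w` these are lifted derivatives of two different functions, and `‖v - w‖` is
the offset `c` in their comparison. -/
theorem LiftC2.norm_derivDm_sub_le (h : LiftC2 K L J) (hL : 0 ≤ L) (v w : RSp d)
    (z z' : RSp d × Lp (RSp d) 2 P) :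
    ‖J.derivDm P v z - J.derivDm P w z'‖ ≤ 5 * L * (‖z - z'‖ + ‖v - w‖) :=
  norm_liftDeriv_sub_le hL (norm_nonneg _) (h.deriv_m v) (h.deriv_m w)
    (fun x μ y ν => h.lip_mx x μ v y ν w)
    (fun x μ v' y ν w' => (h.lip_mm x μ v v' y ν w w').trans (by gcongr 1; linarith)) z z'

theorem LiftC2.norm_derivDm_le (h : LiftC2 K L J) (v : RSp d) (z : RSp d × Lp (RSp d) 2 P) :
    ‖J.derivDm P v z‖ ≤ 2 * K :=
  norm_liftDeriv_le (h.deriv_m v).bound_x (h.deriv_m v).bound_m z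

theorem continuous_of_norm_sub_le {A B : Type*} [SeminormedAddCommGroup A]
    [SeminormedAddCommGroup B] {C : ℝ} {u : A → B} (h : ∀ x y, ‖u x - u y‖ ≤ C * ‖x - y‖) :
    Continuous u :=
  (LipschitzWith.of_dist_le' (K := C) fun x y => by
    rw [dist_eq_norm, dist_eq_norm]; exact h x y).continuous

/-- Lipschitz dependence on `v` in operator norm gives strong measurability after substituting `v =
X(ω)`; boundedness gives integrability. -/
theorem LiftC2.memLp_derivDm (h : LiftC2 K L J) (hL : 0 ≤ L) (z : RSp d × Lp (RSp d) 2 P) :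
    MemLp (fun ω => J.derivDm P (z.2 ω) z) 2 P := by
  have hc : Continuous fun v => J.derivDm P v z :=
    continuous_of_norm_sub_le (C := 5 * L)
      (B := RSp d × Lp (RSp d) 2 P →L[ℝ] RSp d →L[ℝ] F) fun v w => by
      simpa using h.norm_derivDm_sub_le hL v w z z
  exact MemLp.of_bound (E := RSp d × Lp (RSp d) 2 P →L[ℝ] RSp d →L[ℝ] F) (hc.comp_aestronglyMeasurable (Lp.aestronglyMeasurable z.2))
    (2 * K) (.of_forall fun ω => h.norm_derivDm_le _ z)

theorem LiftC2.memLp_dv (h : LiftC2 K L J) (z : RSp d × Lp (RSp d) 2 P) :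
    MemLp (fun ω => J.dv z.1 (lawL2 P z.2) (z.2 ω)) ∞ P := by
  have hc : Continuous fun v => J.dv z.1 (lawL2 P z.2) v :=
    continuous_of_norm_sub_le (C := L) (B := RSp d →L[ℝ] RSp d →L[ℝ] F) fun v w => by
      simpa [wass2_lawL2_self] using h.lip_v z.1 (lawL2 P z.2) v z.1 (lawL2 P z.2) w
  exact memLp_top_of_bound (E := RSp d →L[ℝ] RSp d →L[ℝ] F)
    (hc.comp_aestronglyMeasurable (Lp.aestronglyMeasurable z.2)) K
    (.of_forall fun ω => h.bound_v _ _ _)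

theorem LiftC2.nonneg (h : LiftC2 K L J) (μ : P2 d) : 0 ≤ K :=
  (norm_nonneg _).trans (h.first.bound_x 0 μ)

theorem LiftC2.norm_liftDeriv₂_le (h : LiftC2 K L J) (z : RSp d × Lp (RSp d) 2 P) :
    ‖J.liftDeriv₂ P z‖ ≤ 5 * K := by
  have hK := h.nonneg (lawL2 P z.2)
  have h1 := norm_liftDeriv_le h.deriv_x.bound_x h.deriv_x.bound_m z
  have h2 := norm_pairL2_le_const (P := P) (a := fun ω => (J.derivDm P (z.2 ω) z).flip)
    (C := 2 * K) (by positivity) fun ω => by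
      rw [ContinuousLinearMap.opNorm_flip]; exact h.norm_derivDm_le _ z
  have h3 := norm_mulPair_le (P := P) (B := fun ω => J.dv z.1 (lawL2 P z.2) (z.2 ω)) hK
    fun ω => h.bound_v _ _ _
  refine (norm_stateForm₂_le _ _ _).trans ?_
  linarith

theorem lpInclusion_coeFn {p : ℝ≥0∞} [Fact (1 ≤ p)] (hp : 2 ≤ p) (X : Lp (RSp d) p P) :
    lpInclusion P p hp X =ᵐ[P] X :=
  ((Lp.memLp X).mono_exponent hp).coeFn_toLp

theorem norm_lpInclusion_le {p : ℝ≥0∞} [Fact (1 ≤ p)] (hp : 2 ≤ p) (X : Lp (RSp d) p P) :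
    ‖lpInclusion P p hp X‖ ≤ ‖X‖ := by
  refine (LinearMap.mkContinuous_norm_le _ zero_le_one _ |> ContinuousLinearMap.le_of_opNorm_le _) X
    |>.trans (one_mul _).le

theorem norm_stateEmbedding_le {p : ℝ≥0∞} [Fact (1 ≤ p)] (hp : 2 ≤ p)
    (ξ : RSp d × Lp (RSp d) p P) : ‖stateEmbedding P p hp ξ‖ ≤ ‖ξ‖ :=
  max_le (norm_fst_le ξ) ((norm_lpInclusion_le hp ξ.2).trans (norm_snd_le ξ))

variable {p : ℝ≥0} [Fact (1 ≤ (p : ℝ≥0∞))] {θ : ℝ}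

/-- Hölder continuity of the second derivative along `ℝ^d × L_p`. -/
theorem LiftC2.norm_liftDeriv₂_sub_apply_le (h : LiftC2 K L J) (hL : 0 ≤ L) (hp : 2 ≤ (p : ℝ≥0∞))
    (hθ : 0 < θ) (hθ1 : θ ≤ 1) (hpθ : 2 + θ ≤ p) (z : RSp d × Lp (RSp d) 2 P)
    (ξ η₁ η₂ : RSp d × Lp (RSp d) p P) :
    ‖(J.liftDeriv₂ P (z + stateEmbedding P p hp ξ) - J.liftDeriv₂ P z)
        (stateEmbedding P p hp η₁) (stateEmbedding P p hp η₂)‖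
      ≤ (4 * max (4 * K) (10 * L)) * ‖ξ‖ ^ θ * ‖η₁‖ * ‖η₂‖ := by
  have hK := h.nonneg (lawL2 P z.2)
  set ι := stateEmbedding (d := d) P p hp with hι
  set z' := z + ι ξ with hz'
  set M := max (4 * K) (10 * L) with hM
  set r := ‖ξ‖ with hr
  have hr0 : 0 ≤ r := norm_nonneg _
  have hM0 : 0 ≤ M := (by positivity : (0 : ℝ) ≤ 4 * K).trans (le_max_left _ _)
  have hzz : ‖z' - z‖ ≤ r := by
    rw [hz', add_sub_cancel_left]; exact norm_stateEmbedding_le hp ξ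
  -- Lipschitz and bounded by `2K` at either point, hence `θ`-Hölder by interpolation; `ha` is
  -- handled likewise, and its Lipschitz constant `5L + 5L` is the `10 * L` in `M`.
  have hA : ‖liftDeriv P J.dxx J.dxm z' - liftDeriv P J.dxx J.dxm z‖ ≤ M * r ^ θ := by
    refine le_mul_rpow_of_le_of_le_mul hr0 hθ hθ1 (by positivity) ?_ ?_
    · have h1 := norm_liftDeriv_le h.deriv_x.bound_x h.deriv_x.bound_m z
      have h2 := norm_liftDeriv_le h.deriv_x.bound_x h.deriv_x.bound_m z'
      linarith [norm_sub_le (liftDeriv P J.dxx J.dxm z') (liftDeriv P J.dxx J.dxm z)]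
    · have := h.deriv_x.norm_liftDeriv_sub_le hL z' z
      nlinarith
  have ha : ‖pairL2 P (fun ω => (J.derivDm P (z'.2 ω) z' - J.derivDm P (z.2 ω) z).flip)‖
      ≤ M * r ^ θ := by
    refine le_mul_rpow_of_le_of_le_mul hr0 hθ hθ1 (by positivity) ?_ ?_
    · refine norm_pairL2_le_const (by positivity) fun ω => ?_
      rw [ContinuousLinearMap.opNorm_flip]
      have h1 := h.norm_derivDm_le (z.2 ω) z
      have h2 := h.norm_derivDm_le (z'.2 ω) z'
      linarith [norm_sub_le (J.derivDm P (z'.2 ω) z') (J.derivDm P (z.2 ω) z)]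
    · have := norm_pairL2_le_affine (P := P) (C := 5 * L) (c := r)
        (a := fun ω => (J.derivDm P (z'.2 ω) z' - J.derivDm P (z.2 ω) z).flip)
        (by positivity) hr0 (z'.2 - z.2) ?_
      · have h2 : ‖z'.2 - z.2‖ ≤ r := (norm_snd_sub_le z' z).trans hzz
        nlinarith
      · filter_upwards [Lp.coeFn_sub z'.2 z.2] with ω hω
        rw [ContinuousLinearMap.opNorm_flip, hω, Pi.sub_apply]
        refine (h.norm_derivDm_sub_le hL _ _ _ _).trans ?_
        gcongr
  -- The local term. Its increment is at most `M (r^θ + |ξ(ω)|^θ)`: the deterministic part needs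
  -- Cauchy–Schwarz only, the random part uses `2 + θ ≤ p`.
  have hB : ‖mulPair P (fun ω => J.dv z'.1 (lawL2 P z'.2) (z'.2 ω) - J.dv z.1 (lawL2 P z.2) (z.2 ω))
      (ι η₁).2 (ι η₂).2‖ ≤ 2 * M * r ^ θ * ‖η₁‖ * ‖η₂‖ := by
    refine (norm_mulPair_apply_le _ _ _).trans ?_
    have i1 := integral_rpow_mul_mul_le (P := P) (θ := 0) le_rfl (by linarith) ξ.2 η₁.2 η₂.2
    have i2 := integral_rpow_mul_mul_le (P := P) hθ.le hpθ ξ.2 η₁.2 η₂.2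
    have hdom : (fun ω => ‖(J.dv z'.1 (lawL2 P z'.2) (z'.2 ω) - J.dv z.1 (lawL2 P z.2) (z.2 ω))
          ((ι η₁).2 ω)‖ * ‖(ι η₂).2 ω‖) ≤ᵐ[P]
        fun ω => M * r ^ θ * (‖ξ.2 ω‖ ^ (0 : ℝ) * ‖η₁.2 ω‖ * ‖η₂.2 ω‖)
          + M * (‖ξ.2 ω‖ ^ θ * ‖η₁.2 ω‖ * ‖η₂.2 ω‖) := by
      filter_upwards [lpInclusion_coeFn hp ξ.2, lpInclusion_coeFn hp η₁.2,
        lpInclusion_coeFn hp η₂.2, Lp.coeFn_add z.2 (lpInclusion P p hp ξ.2)] with ω e1 e2 e3 e4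
      have e2' : (ι η₁).2 ω = η₁.2 ω := e2
      have e3' : (ι η₂).2 ω = η₂.2 ω := e3
      have e4' : z'.2 ω - z.2 ω = ξ.2 ω := by
        change (z.2 + lpInclusion P p hp ξ.2 : Lp (RSp d) 2 P) ω - z.2 ω = ξ.2 ω
        rw [e4, Pi.add_apply, e1, add_sub_cancel_left]
      rw [e2', e3']
      have hd : ‖J.dv z'.1 (lawL2 P z'.2) (z'.2 ω) - J.dv z.1 (lawL2 P z.2) (z.2 ω)‖
          ≤ M * (r ^ θ + ‖ξ.2 ω‖ ^ θ) := by
        have := le_mul_rpow_add_rpow_of_le (A := 2 * K) (B := 2 * L) hr0 (norm_nonneg (ξ.2 ω)) hθ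
          hθ1 (by positivity)
          (a := ‖J.dv z'.1 (lawL2 P z'.2) (z'.2 ω) - J.dv z.1 (lawL2 P z.2) (z.2 ω)‖) ?_ ?_
        · refine this.trans ?_
          gcongr
          refine max_le_max ?_ ?_ <;> linarith
        · have h1 := h.bound_v z'.1 (lawL2 P z'.2) (z'.2 ω)
          have h2 := h.bound_v z.1 (lawL2 P z.2) (z.2 ω)
          have h3 := norm_sub_le (J.dv z'.1 (lawL2 P z'.2) (z'.2 ω))
            (J.dv z.1 (lawL2 P z.2) (z.2 ω))
          linarith
        · refine (h.lip_v _ _ _ _ _ _).trans ?_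
          rw [e4']
          have h1 := wass2_lawL2_snd_le z' z
          have h2 := norm_fst_sub_le z' z
          have h3 : ‖z'.1 - z.1‖ + wass2 (lawL2 P z'.2) (lawL2 P z.2) + ‖ξ.2 ω‖
            ≤ 2 * (r + ‖ξ.2 ω‖) := by linarith [norm_nonneg (ξ.2 ω)]
          calc _ ≤ L * (2 * (r + ‖ξ.2 ω‖)) := by gcongr
            _ = _ := by ring
      rw [Real.rpow_zero, one_mul]
      calc _ ≤ M * (r ^ θ + ‖ξ.2 ω‖ ^ θ) * ‖η₁.2 ω‖ * ‖η₂.2 ω‖ := by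
            gcongr
            exact ContinuousLinearMap.le_of_opNorm_le _ hd _
        _ = _ := by ring
    refine (integral_mono_of_nonneg (.of_forall fun _ => by positivity)
      ((i1.1.const_mul _).add (i2.1.const_mul _)) hdom).trans ?_
    rw [integral_add' (i1.1.const_mul _) (i2.1.const_mul _), integral_const_mul,
      integral_const_mul]
    have j1 : ∫ ω, ‖ξ.2 ω‖ ^ (0 : ℝ) * ‖η₁.2 ω‖ * ‖η₂.2 ω‖ ∂P ≤ ‖η₁‖ * ‖η₂‖ := by
      refine i1.2.trans ?_
      rw [Real.rpow_zero, one_mul]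
      exact mul_le_mul (norm_snd_le η₁) (norm_snd_le η₂) (norm_nonneg _) (norm_nonneg _)
    have j2 : ∫ ω, ‖ξ.2 ω‖ ^ θ * ‖η₁.2 ω‖ * ‖η₂.2 ω‖ ∂P ≤ r ^ θ * ‖η₁‖ * ‖η₂‖ := by
      refine i2.2.trans ?_
      gcongr
      · exact norm_snd_le ξ
      · exact norm_snd_le η₁
      · exact norm_snd_le η₂
    calc _ ≤ M * r ^ θ * (‖η₁‖ * ‖η₂‖) + M * (r ^ θ * ‖η₁‖ * ‖η₂‖) := by gcongr
      _ = _ := by ring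
  rw [LiftJet.liftDeriv₂, LiftJet.liftDeriv₂, ← stateForm₂_sub _ _ (h.memLp_derivDm hL z')
    (h.memLp_derivDm hL z) (h.memLp_dv z') (h.memLp_dv z)]
  refine (norm_stateForm₂_apply_le _ _ _ _ _).trans ?_
  have hrθ : 0 ≤ M * r ^ θ := by positivity
  calc _ ≤ (M * r ^ θ + M * r ^ θ) * ‖η₁‖ * ‖η₂‖ + 2 * M * r ^ θ * ‖η₁‖ * ‖η₂‖ := by
        gcongr
        · exact norm_stateEmbedding_le hp η₁
        · exact norm_stateEmbedding_le hp η₂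
    _ = _ := by ring

/-- The remainder of `∂_μ f(x, Law X)(v)` in all variables. -/
def LiftJet.dmRemainder (P : Measure Ω) [IsProbabilityMeasure P] (J : LiftJet d F)
    (z ζ : RSp d × Lp (RSp d) 2 P) (v k w : RSp d) : RSp d →L[ℝ] F :=
  J.dm (z + ζ).1 (lawL2 P (z + ζ).2) w - J.dm z.1 (lawL2 P z.2) v
    - J.derivDm P v z ζ - J.dv z.1 (lawL2 P z.2) v k

/-- Taylor's formula in `v` with exponent `1 + θ` instead of 2: once paired with `|η(ω)|`, a
quadratic remainder would require `p ≥ 3`. -/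
theorem LiftC2.norm_dm_sub_sub_le (h : LiftC2 K L J) (hL : 0 ≤ L) (hθ : 0 < θ) (hθ1 : θ ≤ 1)
    (x : RSp d) (X : Lp (RSp d) 2 P) (v k : RSp d) :
    ‖J.dm x (lawL2 P X) (v + k) - J.dm x (lawL2 P X) v - J.dv x (lawL2 P X) v k‖
      ≤ max (2 * K) L * ‖k‖ ^ θ * ‖k‖ := by
  set μ := lawL2 P X with hμ
  have := (convex_segment v (v + k)).norm_image_sub_le_of_norm_hasFDerivWithin_le'
    (f := J.dm x μ) (f' := J.dv x μ) (C := max (2 * K) L * ‖k‖ ^ θ) (φ := J.dv x μ v)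
    (fun y _ => (h.hasFDerivAt_v x μ y).hasFDerivWithinAt) (fun y hy => ?_)
    (left_mem_segment ℝ v (v + k)) (right_mem_segment ℝ v (v + k))
  · rwa [add_sub_cancel_left] at this
  · have hy' := norm_sub_le_of_mem_segment hy
    rw [add_sub_cancel_left] at hy'
    refine le_mul_rpow_of_le_of_le_mul (norm_nonneg _) hθ hθ1 hL ?_ ?_
    · linarith [h.bound_v x μ y, h.bound_v x μ v, norm_sub_le (J.dv x μ y) (J.dv x μ v)]
    · refine (h.lip_v _ _ _ _ _ _).trans ?_
      rw [hμ, wass2_lawL2_self, sub_self, norm_zero, add_zero, zero_add]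
      gcongr

/-- Three errors: moving `v` at the shifted state, shifting the state inside `D_v ∂_μ f`, and
shifting the state with `v` frozen. Only the first sees more than one power of the random
displacement. -/
theorem LiftC2.norm_dmRemainder_le (h : LiftC2 K L J) (hL : 0 ≤ L) (hθ : 0 < θ) (hθ1 : θ ≤ 1)
    (z ζ : RSp d × Lp (RSp d) 2 P) (v k : RSp d) :
    ‖J.dmRemainder P z ζ v k (v + k)‖
      ≤ max (2 * K) L * ‖k‖ ^ θ * ‖k‖ + 2 * L * ‖ζ‖ * ‖k‖ + 4 * L * ‖ζ‖ ^ 2 := by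
  have r1 := h.norm_dm_sub_sub_le hL hθ hθ1 (z + ζ).1 (z + ζ).2 v k
  have r2 : ‖J.dv (z + ζ).1 (lawL2 P (z + ζ).2) v k - J.dv z.1 (lawL2 P z.2) v k‖
      ≤ 2 * L * ‖ζ‖ * ‖k‖ := by
    rw [← sub_apply]
    refine ContinuousLinearMap.le_of_opNorm_le _ ((h.lip_v _ _ _ _ _ _).trans ?_) _
    rw [sub_self, norm_zero, add_zero]
    have h1 := wass2_lawL2_snd_le (z + ζ) z
    have h2 := norm_fst_sub_le (z + ζ) z
    rw [add_sub_cancel_left] at h1 h2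
    calc _ ≤ L * (‖ζ‖ + ‖ζ‖) := by gcongr
      _ = _ := by ring
  have r3 := (h.deriv_m v).norm_expansion_le hL z ζ
  have hR : J.dmRemainder P z ζ v k (v + k)
      = (J.dm (z + ζ).1 (lawL2 P (z + ζ).2) (v + k) - J.dm (z + ζ).1 (lawL2 P (z + ζ).2) v
          - J.dv (z + ζ).1 (lawL2 P (z + ζ).2) v k)
        + (J.dv (z + ζ).1 (lawL2 P (z + ζ).2) v k - J.dv z.1 (lawL2 P z.2) v k)
        + (J.dm (z + ζ).1 (lawL2 P (z + ζ).2) v - J.dm z.1 (lawL2 P z.2) v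
          - J.derivDm P v z ζ) := by
    rw [LiftJet.dmRemainder]
    abel
  rw [hR]
  exact norm_add₃_le.trans (add_le_add (add_le_add r1 r2) r3)

theorem memLp_eval {E G : Type*} [NormedAddCommGroup E] [NormedSpace ℝ E] [NormedAddCommGroup G]
    [NormedSpace ℝ G] {q : ℝ≥0∞} {A : Ω → E →L[ℝ] G} (h : MemLp A q P) (ζ : E) :
    MemLp (fun ω => A ω ζ) q P :=
  (ContinuousLinearMap.apply ℝ G ζ).comp_memLp' h

theorem pairL2_sub_sub_sub {a b c e : Ω → RSp d →L[ℝ] F} (ha : MemLp a 2 P) (hb : MemLp b 2 P)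
    (hc : MemLp c 2 P) (he : MemLp e 2 P) :
    pairL2 P (fun ω => a ω - b ω - c ω - e ω)
      = pairL2 P a - pairL2 P b - pairL2 P c - pairL2 P e := by
  have hab : MemLp (fun ω => a ω - b ω) 2 P := ha.sub hb
  have habc : MemLp (fun ω => a ω - b ω - c ω) 2 P := hab.sub hc
  rw [pairL2_sub habc he, pairL2_sub hab hc, pairL2_sub ha hb]

/-- An exact identity by linearity of the pairing: the `x` component carries the remainder of `D_x
f`, the random component the pointwise remainder of `∂_μ f`. -/
theorem LiftC2.liftDeriv_sub_sub_apply (h : LiftC2 K L J) (hL : 0 ≤ L)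
    (z ζ η : RSp d × Lp (RSp d) 2 P) :
    (liftDeriv P J.dx J.dm (z + ζ) - liftDeriv P J.dx J.dm z - J.liftDeriv₂ P z ζ) η
      = (J.dx (z + ζ).1 (lawL2 P (z + ζ).2) - J.dx z.1 (lawL2 P z.2)
          - liftDeriv P J.dxx J.dxm z ζ) η.1
        + pairL2 P (fun ω => J.dmRemainder P z ζ (z.2 ω) (ζ.2 ω) ((z + ζ).2 ω)) η.2 := by
  have m1 := h.first.memLp (z + ζ)
  have m2 := h.first.memLp z
  have m3 : MemLp (fun ω => J.derivDm P (z.2 ω) z ζ) 2 P :=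
    memLp_eval (h.memLp_derivDm hL z) ζ
  have m4 : MemLp (fun ω => J.dv z.1 (lawL2 P z.2) (z.2 ω) (ζ.2 ω)) 2 P :=
    memLp_apply_of_memLp_top (h.memLp_dv z) ζ.2
  have e1 := DFunLike.congr_fun (pairL2_flip_apply (h.memLp_derivDm hL z) ζ) η.2
  have e2 := mulPair_apply (h.memLp_dv z) ζ.2
  have e3 : pairL2 P (fun ω => J.dmRemainder P z ζ (z.2 ω) (ζ.2 ω) ((z + ζ).2 ω))
      = pairL2 P (fun ω => J.dm (z + ζ).1 (lawL2 P (z + ζ).2) ((z + ζ).2 ω))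
        - pairL2 P (fun ω => J.dm z.1 (lawL2 P z.2) (z.2 ω))
        - pairL2 P (fun ω => J.derivDm P (z.2 ω) z ζ)
        - pairL2 P (fun ω => J.dv z.1 (lawL2 P z.2) (z.2 ω) (ζ.2 ω)) :=
    pairL2_sub_sub_sub m1 m2 m3 m4
  rw [ContinuousLinearMap.flip_apply] at e1
  rw [e3, ← e2]
  simp only [sub_apply]
  rw [← e1, LiftJet.liftDeriv₂, stateForm₂_apply, liftDeriv, liftDeriv, stateForm_apply,
    stateForm_apply]
  abel

/-- First-order expansion of the first derivative along `ℝ^d × L_p`. -/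
theorem LiftC2.norm_liftDeriv_expansion_le (h : LiftC2 K L J) (hL : 0 ≤ L) (hp : 2 ≤ (p : ℝ≥0∞))
    (hθ : 0 < θ) (hθ1 : θ ≤ 1) (hpθ : 2 + θ ≤ p) (z : RSp d × Lp (RSp d) 2 P)
    (ξ η : RSp d × Lp (RSp d) p P) :
    ‖(liftDeriv P J.dx J.dm (z + stateEmbedding P p hp ξ) - liftDeriv P J.dx J.dm z
        - J.liftDeriv₂ P z (stateEmbedding P p hp ξ)) (stateEmbedding P p hp η)‖
      ≤ (max (2 * K) L * ‖ξ‖ ^ θ + 10 * L * ‖ξ‖) * ‖ξ‖ * ‖η‖ := by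
  set ι := stateEmbedding (d := d) P p hp with hι
  set M := max (2 * K) L with hM
  set r := ‖ξ‖ with hr
  have hr0 : 0 ≤ r := norm_nonneg _
  have hM0 : 0 ≤ M := hL.trans (le_max_right _ _)
  have hιr : ‖ι ξ‖ ≤ r := norm_stateEmbedding_le hp ξ
  have hfirst : ‖(J.dx (z + ι ξ).1 (lawL2 P (z + ι ξ).2) - J.dx z.1 (lawL2 P z.2)
      - liftDeriv P J.dxx J.dxm z (ι ξ)) (ι η).1‖ ≤ 4 * L * r ^ 2 * ‖η‖ := by
    refine (ContinuousLinearMap.le_opNorm _ _).trans ?_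
    gcongr
    · exact (h.deriv_x.norm_expansion_le hL z (ι ξ)).trans (by gcongr)
    · exact norm_fst_le η
  -- One integrable majorant for each of the three terms in the remainder of `∂_μ f`; in total `10 *
  -- L` is `4L` from the `x` component plus `2L + 4L`.
  have i1 := integral_rpow_mul_mul_le (P := P) hθ.le hpθ ξ.2 ξ.2 η.2
  have i2 := integral_rpow_mul_mul_le (P := P) (θ := 0) le_rfl (by linarith) ξ.2 ξ.2 η.2
  have i3 := integral_norm_lp_le (P := P) η.2
  have hdom : (fun ω => ‖J.dmRemainder P z (ι ξ) (z.2 ω) ((ι ξ).2 ω) ((z + ι ξ).2 ω)‖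
      * ‖(ι η).2 ω‖) ≤ᵐ[P]
      fun ω => M * (‖ξ.2 ω‖ ^ θ * ‖ξ.2 ω‖ * ‖η.2 ω‖)
        + 2 * L * r * (‖ξ.2 ω‖ ^ (0 : ℝ) * ‖ξ.2 ω‖ * ‖η.2 ω‖) + 4 * L * r ^ 2 * ‖η.2 ω‖ := by
    filter_upwards [lpInclusion_coeFn hp ξ.2, lpInclusion_coeFn hp η.2,
      Lp.coeFn_add z.2 (lpInclusion P p hp ξ.2)] with ω e1 e2 e4
    have e1' : (ι ξ).2 ω = ξ.2 ω := e1
    have e2' : (ι η).2 ω = η.2 ω := e2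
    have e4' : (z + ι ξ).2 ω = z.2 ω + ξ.2 ω := by
      change (z.2 + lpInclusion P p hp ξ.2 : Lp (RSp d) 2 P) ω = _
      rw [e4, Pi.add_apply, e1]
    rw [e1', e2', e4', Real.rpow_zero, one_mul]
    have hR := h.norm_dmRemainder_le hL hθ hθ1 z (ι ξ) (z.2 ω) (ξ.2 ω)
    calc _ ≤ (M * ‖ξ.2 ω‖ ^ θ * ‖ξ.2 ω‖ + 2 * L * r * ‖ξ.2 ω‖ + 4 * L * r ^ 2) * ‖η.2 ω‖ := by
          gcongr
          exact hR.trans (by gcongr)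
      _ = _ := by ring
  have j1 : ∫ ω, ‖ξ.2 ω‖ ^ θ * ‖ξ.2 ω‖ * ‖η.2 ω‖ ∂P ≤ r ^ θ * r * ‖η‖ := by
    refine i1.2.trans ?_
    gcongr
    · exact norm_snd_le ξ
    · exact norm_snd_le ξ
    · exact norm_snd_le η
  have j2 : ∫ ω, ‖ξ.2 ω‖ ^ (0 : ℝ) * ‖ξ.2 ω‖ * ‖η.2 ω‖ ∂P ≤ r * ‖η‖ := by
    refine i2.2.trans ?_
    rw [Real.rpow_zero, one_mul]
    exact mul_le_mul (norm_snd_le ξ) (norm_snd_le η) (norm_nonneg _) (norm_nonneg _)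
  have j3 : ∫ ω, ‖η.2 ω‖ ∂P ≤ ‖η‖ := i3.2.trans (norm_snd_le η)
  have hsecond : ‖pairL2 P
      (fun ω => J.dmRemainder P z (ι ξ) (z.2 ω) ((ι ξ).2 ω) ((z + ι ξ).2 ω)) (ι η).2‖
      ≤ (M * r ^ θ + 6 * L * r) * r * ‖η‖ := by
    refine (norm_pairL2_apply_le _ _).trans ?_
    refine (integral_mono_of_nonneg (.of_forall fun _ => by positivity)
      (((i1.1.const_mul _).add (i2.1.const_mul _)).add (i3.1.const_mul _)) hdom).trans ?_
    rw [integral_add' ((i1.1.const_mul _).add (i2.1.const_mul _)) (i3.1.const_mul _),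
      integral_add' (i1.1.const_mul _) (i2.1.const_mul _), integral_const_mul,
      integral_const_mul, integral_const_mul]
    calc _ ≤ M * (r ^ θ * r * ‖η‖) + 2 * L * r * (r * ‖η‖) + 4 * L * r ^ 2 * ‖η‖ := by gcongr
      _ = _ := by ring
  rw [h.liftDeriv_sub_sub_apply hL]
  refine (norm_add_le _ _).trans ((add_le_add hfirst hsecond).trans (le_of_eq ?_))
  ring

end LiftC2

/-! ### Derivatives along a subspace of order at most two -/

section MultilinearNorm

variable {X Y : Type*} [NormedAddCommGroup X] [NormedSpace ℝ X] [NormedAddCommGroup Y]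
  [NormedSpace ℝ Y]

/-- This and the next two results pass from estimates on values or curried operators to the
multilinear norms in which `derivAlong` is measured. -/
theorem norm_multilinear_zero_le {M : ContinuousMultilinearMap ℝ (fun _ : Fin 0 => X) Y} {C : ℝ}
    (h : ∀ m, ‖M m‖ ≤ C) : ‖M‖ ≤ C :=
  M.opNorm_le_bound ((norm_nonneg _).trans (h 0)) fun m => by simpa using h m

theorem norm_multilinear_one_le {M : ContinuousMultilinearMap ℝ (fun _ : Fin 1 => X) Y}
    {A : X →L[ℝ] Y} {C : ℝ} (h : ∀ m, M m = A (m 0)) (hA : ‖A‖ ≤ C) : ‖M‖ ≤ C :=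
  M.opNorm_le_bound ((norm_nonneg _).trans hA) fun m => by
    rw [h, Fin.prod_univ_one]; exact A.le_of_opNorm_le hA _

theorem norm_multilinear_two_le {M : ContinuousMultilinearMap ℝ (fun _ : Fin 2 => X) Y}
    {A : X →L[ℝ] X →L[ℝ] Y} {C : ℝ} (h : ∀ m, M m = A (m 0) (m 1)) (hA : ‖A‖ ≤ C) : ‖M‖ ≤ C :=
  M.opNorm_le_bound ((norm_nonneg A).trans hA) fun m => by
    rw [h, Fin.prod_univ_two, ← mul_assoc]
    exact (A.le_opNorm₂ _ _).trans (by gcongr)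

end MultilinearNorm

section DerivAlong

variable {E X Y : Type*} [AddCommGroup E] [Module ℝ E] [TopologicalSpace E]
  [NormedAddCommGroup X] [NormedSpace ℝ X] [NormedAddCommGroup Y] [NormedSpace ℝ Y]
  {ι : X →L[ℝ] E} {g : E → Y} {D : E → X →L[ℝ] Y} {D₂ : E → X →L[ℝ] X →L[ℝ] Y}

/-- `D` is the first derivative of `g` along `ι`. -/
def HasDerivAlong (ι : X →L[ℝ] E) (g : E → Y) (D : E → X →L[ℝ] Y) : Prop :=
  ∀ z, HasFDerivAt (fun ξ => g (z + ι ξ)) (D z) 0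

/-- The base point ranges over all of `E`, so translating by `ι ξ` turns differentiability at `0`
into differentiability everywhere. -/
theorem HasDerivAlong.hasFDerivAt (h : HasDerivAlong ι g D) (z : E) (ξ : X) :
    HasFDerivAt (fun ξ => g (z + ι ξ)) (D (z + ι ξ)) ξ := by
  have h1 : HasFDerivAt (fun η : X => η - ξ) (ContinuousLinearMap.id ℝ X) ξ :=
    (hasFDerivAt_id ξ).sub_const ξ
  have h2 : HasFDerivAt (fun η => g (z + ι ξ + ι η)) (D (z + ι ξ)) (ξ - ξ) := by
    rw [sub_self]; exact h (z + ι ξ)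
  have h3 := h2.comp (f := fun η => η - ξ) ξ h1
  rw [ContinuousLinearMap.comp_id] at h3
  refine h3.congr_of_eventuallyEq (.of_forall fun η => ?_)
  simp [map_sub]

theorem HasDerivAlong.fderiv (h : HasDerivAlong ι g D) (z : E) :
    fderiv ℝ (fun ξ => g (z + ι ξ)) = fun ξ => D (z + ι ξ) :=
  funext fun ξ => (h.hasFDerivAt z ξ).fderiv

theorem derivAlong_zero_apply (g : E → Y) (z : E) (m : Fin 0 → X) : derivAlong ι 0 g z m = g z := by
  simp [derivAlong]

theorem HasDerivAlong.derivAlong_one_apply (h : HasDerivAlong ι g D) (z : E) (m : Fin 1 → X) :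
    derivAlong ι 1 g z m = D z (m 0) := by
  rw [derivAlong, iteratedFDeriv_one_apply, h.fderiv]
  simp

theorem HasDerivAlong.derivAlong_two_apply (h : HasDerivAlong ι g D) (h₂ : HasDerivAlong ι D D₂)
    (z : E) (m : Fin 2 → X) : derivAlong ι 2 g z m = D₂ z (m 0) (m 1) := by
  rw [derivAlong, iteratedFDeriv_two_apply, h.fderiv, h₂.fderiv]
  simp

theorem HasDerivAlong.differentiable (h : HasDerivAlong ι g D) (z : E) :
    Differentiable ℝ (fun ξ => g (z + ι ξ)) := fun ξ => (h.hasFDerivAt z ξ).differentiableAt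

theorem HasDerivAlong.differentiable_iteratedFDeriv_zero (h : HasDerivAlong ι g D) (z : E) :
    Differentiable ℝ (iteratedFDeriv ℝ 0 fun ξ => g (z + ι ξ)) := by
  rw [iteratedFDeriv_zero_eq_comp, LinearIsometryEquiv.comp_differentiable_iff]
  exact h.differentiable z

theorem HasDerivAlong.differentiable_iteratedFDeriv_one (h : HasDerivAlong ι g D)
    (h₂ : HasDerivAlong ι D D₂) (z : E) :
    Differentiable ℝ (iteratedFDeriv ℝ 1 fun ξ => g (z + ι ξ)) := by
  have h1 : iteratedFDeriv ℝ 1 (fun ξ => g (z + ι ξ))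
      = (continuousMultilinearCurryFin1 ℝ X Y).symm ∘ fun ξ => D (z + ι ξ) := by
    ext ξ m
    rw [iteratedFDeriv_one_apply, h.fderiv]
    rfl
  rw [h1, LinearIsometryEquiv.comp_differentiable_iff]
  exact h₂.differentiable z

theorem ckbAlongWith_of_intOrder_zero {k K : ℝ} (hk : intOrder k = 0) (hb : ∀ z, ‖g z‖ ≤ K)
    (hh : HolderAlongWith ι K (fracOrder k) g) : CkbAlongWith ι k K g where
  differentiable := by simp [hk]
  bound := hb
  bound_deriv j h1 h2 := by omega
  holder := by
    rw [hk]
    intro z ξ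
    refine norm_multilinear_zero_le fun m => ?_
    simpa [derivAlong_zero_apply] using hh z ξ

theorem ckbAlongWith_of_intOrder_one {k K : ℝ} (hk : intOrder k = 1) (hb : ∀ z, ‖g z‖ ≤ K)
    (h : HasDerivAlong ι g D) (hD : ∀ z, ‖D z‖ ≤ K)
    (hh : HolderAlongWith ι K (fracOrder k) D) : CkbAlongWith ι k K g where
  differentiable z j hj := by
    obtain rfl : j = 0 := by omega
    exact h.differentiable_iteratedFDeriv_zero z
  bound := hb
  bound_deriv j h1 h2 z := by
    obtain rfl : j = 1 := by omega
    exact norm_multilinear_one_le (h.derivAlong_one_apply z) (hD z)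
  holder := by
    rw [hk]
    intro z ξ
    refine norm_multilinear_one_le (A := D (z + ι ξ) - D z) (fun m => ?_) (hh z ξ)
    simp [h.derivAlong_one_apply]

theorem ckbAlongWith_of_intOrder_two {k K : ℝ} (hk : intOrder k = 2) (hb : ∀ z, ‖g z‖ ≤ K)
    (h : HasDerivAlong ι g D) (hD : ∀ z, ‖D z‖ ≤ K)
    (h₂ : HasDerivAlong ι D D₂) (hD₂ : ∀ z, ‖D₂ z‖ ≤ K)
    (hh : HolderAlongWith ι K (fracOrder k) D₂) : CkbAlongWith ι k K g where
  differentiable z j hj := by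
    obtain rfl | rfl : j = 0 ∨ j = 1 := by omega
    · exact h.differentiable_iteratedFDeriv_zero z
    · exact h.differentiable_iteratedFDeriv_one h₂ z
  bound := hb
  bound_deriv j h1 h2 z := by
    obtain rfl | rfl : j = 1 ∨ j = 2 := by omega
    · exact norm_multilinear_one_le (h.derivAlong_one_apply z) (hD z)
    · exact norm_multilinear_two_le (h.derivAlong_two_apply h₂ z) (hD₂ z)
  holder := by
    rw [hk]
    intro z ξ
    refine norm_multilinear_two_le (A := D₂ (z + ι ξ) - D₂ z) (fun m => ?_) (hh z ξ)
    simp [h.derivAlong_two_apply h₂]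

/-- A remainder of order `o(|ξ|)` yields differentiability along `ι`. -/
theorem hasDerivAlong_of_norm_le {φ : ℝ → ℝ} (hφ : ContinuousAt φ 0) (hφ0 : φ 0 = 0)
    (h : ∀ z ξ, ‖g (z + ι ξ) - g z - D z ξ‖ ≤ φ ‖ξ‖ * ‖ξ‖) : HasDerivAlong ι g D := by
  intro z
  rw [hasFDerivAt_iff_isLittleO_nhds_zero]
  have h0 : Filter.Tendsto (fun ξ : X => φ ‖ξ‖) (nhds 0) (nhds 0) := by
    have : Filter.Tendsto (fun ξ : X => ‖ξ‖) (nhds 0) (nhds 0) := by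
      simpa using (continuous_norm (E := X)).tendsto 0
    have h1 := hφ.tendsto.comp this
    rwa [hφ0] at h1
  have h1 : (fun ξ : X => φ ‖ξ‖ * ‖ξ‖) =o[nhds 0] fun ξ : X => ‖ξ‖ := by
    simpa using ((Asymptotics.isLittleO_one_iff ℝ).2 h0).mul_isBigO
      (Asymptotics.isBigO_refl (fun ξ : X => ‖ξ‖) (nhds 0))
  refine (Asymptotics.IsBigO.of_norm_le fun ξ => ?_).trans_isLittleO h1 |>.of_norm_right
  simpa using h z ξ

/-- Uniform Hölder continuity in time is continuity into the space of functions with uniform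
convergence, and a continuous map on a compact interval is strongly measurable. -/
theorem stronglyMeasurable_ofFun_of_holder {T α C : ℝ} (hα : 0 < α)
    {u : Icc (0 : ℝ) T → E → Y}
    (h : ∀ s t : Icc (0 : ℝ) T, s < t → ∀ z, ‖u t z - u s z‖ ≤ C * |(t : ℝ) - s| ^ α) :
    StronglyMeasurable fun t => UniformFun.ofFun (u t) := by
  have hsymm : ∀ s t : Icc (0 : ℝ) T, ∀ z, ‖u t z - u s z‖ ≤ C * |(t : ℝ) - s| ^ α := by
    intro s t z
    rcases lt_trichotomy s t with hst | rfl | hst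
    · exact h s t hst z
    · simp [hα.ne']
    · rw [norm_sub_rev, abs_sub_comm]; exact h t s hst z
  refine Continuous.stronglyMeasurable (continuous_iff_continuousAt.2 fun s => ?_)
  rw [ContinuousAt, UniformFun.tendsto_iff_tendstoUniformly, Metric.tendstoUniformly_iff]
  intro ε hε
  have h0 : Filter.Tendsto (fun t : Icc (0 : ℝ) T => C * |(t : ℝ) - s| ^ α) (nhds s) (nhds 0) := by
    have hc : Continuous fun t : Icc (0 : ℝ) T => C * |(t : ℝ) - s| ^ α :=
      continuous_const.mul ((by fun_prop : Continuous fun t : Icc (0 : ℝ) T =>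
        |(t : ℝ) - s|).rpow_const fun _ => Or.inr hα.le)
    simpa [hα.ne'] using hc.tendsto s
  filter_upwards [h0.eventually (gt_mem_nhds hε)] with t ht z
  rw [dist_comm, dist_eq_norm]
  exact (hsymm s t z).trans_lt ht

end DerivAlong

/-! ### Lifted coefficients along `ℝ^d × L_p` -/

section Embedding

variable {Ω : Type*} [MeasurableSpace Ω] {P : Measure Ω} [IsProbabilityMeasure P] {d : ℕ}
  {F : Type*} [NormedAddCommGroup F] [NormedSpace ℝ F]
  {p : ℝ≥0} [Fact (1 ≤ (p : ℝ≥0∞))] (hp : 2 ≤ (p : ℝ≥0∞))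

theorem norm_stateEmbedding_opNorm_le : ‖stateEmbedding (d := d) P p hp‖ ≤ 1 :=
  ContinuousLinearMap.opNorm_le_bound _ zero_le_one fun ξ => by
    rw [one_mul]; exact norm_stateEmbedding_le hp ξ

theorem norm_comp_stateEmbedding_le (A : RSp d × Lp (RSp d) 2 P →L[ℝ] F) :
    ‖A.comp (stateEmbedding P p hp)‖ ≤ ‖A‖ :=
  (A.opNorm_comp_le _).trans
    (mul_le_of_le_one_right (norm_nonneg _) (norm_stateEmbedding_opNorm_le hp))

theorem norm_bilinearComp_stateEmbedding_le
    (A : RSp d × Lp (RSp d) 2 P →L[ℝ] RSp d × Lp (RSp d) 2 P →L[ℝ] F) :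
    ‖A.bilinearComp (stateEmbedding P p hp) (stateEmbedding P p hp)‖ ≤ ‖A‖ :=
  ContinuousLinearMap.opNorm_le_bound₂ _ (norm_nonneg A) fun ξ η =>
    (A.le_opNorm₂ _ _).trans (by
      gcongr
      · exact norm_stateEmbedding_le hp ξ
      · exact norm_stateEmbedding_le hp η)

variable [CompleteSpace F] {K L θ : ℝ}

/-- The remainder is quadratic already in `L₂`; `L_p` enters only through the contraction `L_p ⊆
L_2`. -/
theorem LiftC1.hasDerivAlong {g : RSp d → P2 d → F} {dx : RSp d → P2 d → (RSp d →L[ℝ] F)}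
    {dm : RSp d → P2 d → RSp d → (RSp d →L[ℝ] F)} (h : LiftC1 K L g dx dm) (hL : 0 ≤ L) :
    HasDerivAlong (stateEmbedding P p hp)
      (fun z : RSp d × Lp (RSp d) 2 P => g z.1 (lawL2 P z.2))
      (fun z => (liftDeriv P dx dm z).comp (stateEmbedding P p hp)) := by
  refine hasDerivAlong_of_norm_le (φ := fun r => 4 * L * r) (by fun_prop) (by simp) fun z ξ => ?_
  refine (h.norm_expansion_le hL z (stateEmbedding P p hp ξ)).trans ?_
  have := norm_stateEmbedding_le hp ξ
  calc _ ≤ 4 * L * ‖ξ‖ ^ 2 := by gcongr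
    _ = _ := by ring

theorem LiftC1.holderAlongWith {g : RSp d → P2 d → F} {dx : RSp d → P2 d → (RSp d →L[ℝ] F)}
    {dm : RSp d → P2 d → RSp d → (RSp d →L[ℝ] F)} (h : LiftC1 K L g dx dm) (hL : 0 ≤ L)
    (hθ : 0 < θ) (hθ1 : θ ≤ 1) :
    HolderAlongWith (stateEmbedding P p hp) (max (4 * K) (5 * L)) θ
      (fun z => (liftDeriv P dx dm z).comp (stateEmbedding P p hp)) := by
  intro z ξ
  rw [← ContinuousLinearMap.sub_comp]
  refine (norm_comp_stateEmbedding_le hp _).trans ?_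
  refine le_mul_rpow_of_le_of_le_mul (norm_nonneg _) hθ hθ1 (by positivity) ?_ ?_
  · have h1 := norm_liftDeriv_le h.bound_x h.bound_m z
    have h2 := norm_liftDeriv_le h.bound_x h.bound_m (z + stateEmbedding P p hp ξ)
    exact (_root_.norm_sub_le _ _).trans (by linarith)
  · refine (h.norm_liftDeriv_sub_le hL _ _).trans ?_
    rw [add_sub_cancel_left]
    gcongr
    exact norm_stateEmbedding_le hp ξ

/-- Here `L_p` matters: the rate `r^θ` comes from the `D_v ∂_μ f` part of the remainder, estimated
against directions in `L_p`. -/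
theorem LiftC2.hasDerivAlong {J : LiftJet d F} (h : LiftC2 K L J) (hL : 0 ≤ L)
    (hθ : 0 < θ) (hθ1 : θ ≤ 1) (hpθ : 2 + θ ≤ p) :
    HasDerivAlong (stateEmbedding P p hp)
      (fun z => (liftDeriv P J.dx J.dm z).comp (stateEmbedding P p hp))
      (fun z => (J.liftDeriv₂ P z).bilinearComp (stateEmbedding P p hp)
        (stateEmbedding P p hp)) := by
  refine hasDerivAlong_of_norm_le (φ := fun r => max (2 * K) L * r ^ θ + 10 * L * r) ?_
    (by simp [hθ.ne']) fun z ξ => ?_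
  · exact (continuousAt_const.mul (Real.continuousAt_rpow_const _ _ (Or.inr hθ.le))).add
      (by fun_prop)
  · have hM : 0 ≤ max (2 * K) L := hL.trans (le_max_right _ _)
    refine ContinuousLinearMap.opNorm_le_bound _ (by positivity) fun η => ?_
    exact h.norm_liftDeriv_expansion_le hL hp hθ hθ1 hpθ z ξ η

theorem LiftC2.holderAlongWith {J : LiftJet d F} (h : LiftC2 K L J) (hL : 0 ≤ L)
    (hθ : 0 < θ) (hθ1 : θ ≤ 1) (hpθ : 2 + θ ≤ p) :
    HolderAlongWith (stateEmbedding P p hp) (4 * max (4 * K) (10 * L)) θ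
      (fun z => (J.liftDeriv₂ P z).bilinearComp (stateEmbedding P p hp)
        (stateEmbedding P p hp)) := by
  intro z ξ
  have hM : 0 ≤ max (4 * K) (10 * L) := (by positivity : 0 ≤ 10 * L).trans (le_max_right _ _)
  refine ContinuousLinearMap.opNorm_le_bound₂ _ (by positivity) fun η₁ η₂ => ?_
  exact h.norm_liftDeriv₂_sub_apply_le hL hp hθ hθ1 hpθ z ξ η₁ η₂

end Embedding

/-! ### Differences of lifted derivatives at a fixed point -/

section Differences

variable {Ω : Type*} [MeasurableSpace Ω] {P : Measure Ω} [IsProbabilityMeasure P] {d : ℕ}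
  {F G : Type*} [NormedAddCommGroup F] [NormedSpace ℝ F] [CompleteSpace F]
  [NormedAddCommGroup G] [NormedSpace ℝ G] [CompleteSpace G]
  {g g' : RSp d → P2 d → F} {dx dx' : RSp d → P2 d → (RSp d →L[ℝ] F)}
  {dm dm' : RSp d → P2 d → RSp d → (RSp d →L[ℝ] F)}
  {u : RSp d → P2 d → G} {ux : RSp d → P2 d → (RSp d →L[ℝ] G)}
  {um : RSp d → P2 d → RSp d → (RSp d →L[ℝ] G)} {K L K' L' K'' L'' c : ℝ}

/-- Used for time increments. The two lifts are evaluated at the same state, so sup bounds on the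
coefficients suffice and no displacement is involved. -/
theorem LiftC1.norm_liftDeriv_sub_le_const (h : LiftC1 K L g dx dm) (h' : LiftC1 K' L' g' dx' dm')
    (hx : ∀ x μ, ‖dx x μ - dx' x μ‖ ≤ c) (hm : ∀ x μ v, ‖dm x μ v - dm' x μ v‖ ≤ c)
    (z : RSp d × Lp (RSp d) 2 P) :
    ‖liftDeriv P dx dm z - liftDeriv P dx' dm' z‖ ≤ 2 * c := by
  rw [liftDeriv, liftDeriv, ← stateForm_sub _ _ (h.memLp z) (h'.memLp z)]
  exact norm_stateForm_le (hx _ _) fun _ => hm _ _ _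

/-- With `S` the evaluation at `δW`, this passes the controlled remainders of `D_x f` and `∂_μ f` to
the lifted derivative. -/
theorem LiftC1.norm_liftDeriv_sub_sub_comp_le (h : LiftC1 K L g dx dm)
    (h' : LiftC1 K' L' g' dx' dm') (hu : LiftC1 K'' L'' u ux um) (S : G →L[ℝ] F)
    (hx : ∀ x μ, ‖dx x μ - dx' x μ - S.comp (ux x μ)‖ ≤ c)
    (hm : ∀ x μ v, ‖dm x μ v - dm' x μ v - S.comp (um x μ v)‖ ≤ c)
    (z : RSp d × Lp (RSp d) 2 P) :
    ‖liftDeriv P dx dm z - liftDeriv P dx' dm' z - S.comp (liftDeriv P ux um z)‖ ≤ 2 * c := by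
  have hs : MemLp (fun ω => dm z.1 (lawL2 P z.2) (z.2 ω) - dm' z.1 (lawL2 P z.2) (z.2 ω)) 2 P :=
    (h.memLp z).sub (h'.memLp z)
  rw [liftDeriv, liftDeriv, liftDeriv, ← stateForm_sub _ _ (h.memLp z) (h'.memLp z),
    ← stateForm_comp_left _ (hu.memLp z), ← stateForm_sub _ _ hs (memLp_comp_left (hu.memLp z) S)]
  exact norm_stateForm_le (hx _ _) fun _ => hm _ _ _

/-- The local term now differs by at most `c` uniformly in `ω`, so its operator norm on `L₂` is
enough; `5 = 2 + 2 + 1`. -/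
theorem LiftC2.norm_liftDeriv₂_sub_le_const {J J' : LiftJet d F} (h : LiftC2 K L J) (hL : 0 ≤ L)
    (h' : LiftC2 K' L' J') (hL' : 0 ≤ L')
    (hxx : ∀ x μ, ‖J.dxx x μ - J'.dxx x μ‖ ≤ c)
    (hxm : ∀ x μ v, ‖J.dxm x μ v - J'.dxm x μ v‖ ≤ c)
    (hmx : ∀ x μ v, ‖J.dmx x μ v - J'.dmx x μ v‖ ≤ c)
    (hmm : ∀ x μ v w, ‖J.dmm x μ v w - J'.dmm x μ v w‖ ≤ c)
    (hv : ∀ x μ v, ‖J.dv x μ v - J'.dv x μ v‖ ≤ c) (z : RSp d × Lp (RSp d) 2 P) :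
    ‖J.liftDeriv₂ P z - J'.liftDeriv₂ P z‖ ≤ 5 * c := by
  have hc : 0 ≤ c := (norm_nonneg (J.dxx z.1 (lawL2 P z.2) - J'.dxx z.1 (lawL2 P z.2))).trans
    (hxx z.1 (lawL2 P z.2))
  rw [LiftJet.liftDeriv₂, LiftJet.liftDeriv₂, ← stateForm₂_sub _ _ (h.memLp_derivDm hL z)
    (h'.memLp_derivDm hL' z) (h.memLp_dv z) (h'.memLp_dv z)]
  refine (norm_stateForm₂_le _ _ _).trans ?_
  have h1 := h.deriv_x.norm_liftDeriv_sub_le_const h'.deriv_x hxx hxm z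
  have h2 := norm_pairL2_le_const (P := P) (C := 2 * c)
    (a := fun ω => (J.derivDm P (z.2 ω) z - J'.derivDm P (z.2 ω) z).flip) (by positivity)
    fun ω => by
      rw [ContinuousLinearMap.opNorm_flip]
      exact (h.deriv_m _).norm_liftDeriv_sub_le_const (h'.deriv_m _) (fun x μ => hmx x μ _)
        (fun x μ => hmm x μ _) z
  have h3 := norm_mulPair_le (P := P) hc
    (B := fun ω => J.dv z.1 (lawL2 P z.2) (z.2 ω) - J'.dv z.1 (lawL2 P z.2) (z.2 ω))
    fun ω => hv _ _ _
  linarith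

end Differences

/-! ### Consequences of the assumptions on the coefficients -/

section Assumptions

open Filter

/-- Bounds are phrased as holding for all large constants, so that finitely many assumptions can
share one constant. -/
theorem GloballyBounded.eventually {S A F : Type*} [NormedAddCommGroup F] {h : S → A → F}
    (hb : GloballyBounded h) : ∀ᶠ K : ℝ in atTop, ∀ t a, ‖h t a‖ ≤ K := by
  obtain ⟨K₀, hK⟩ := hb
  filter_upwards [eventually_ge_atTop K₀] with K hK' t a
  exact (hK t a).trans hK'

theorem UniformlyLipschitz.eventually {S A F : Type*} [NormedAddCommGroup F] {ρ : A → A → ℝ}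
    {h : S → A → F} (hl : UniformlyLipschitz ρ h) (hρ : ∀ a a', 0 ≤ ρ a a') :
    ∀ᶠ L : ℝ in atTop, ∀ t a a', ‖h t a - h t a'‖ ≤ L * ρ a a' := by
  obtain ⟨L₀, hL⟩ := hl
  filter_upwards [eventually_ge_atTop L₀] with L hL' t a a'
  exact (hL t a a').trans (mul_le_mul_of_nonneg_right hL' (hρ a a'))

theorem UniformlyTimeHolder.eventually {T α : ℝ} {A F : Type*} [NormedAddCommGroup F]
    {h : Icc (0 : ℝ) T → A → F} (hh : UniformlyTimeHolder α h) :
    ∀ᶠ C : ℝ in atTop, ∀ (s t : Icc (0 : ℝ) T) (a : A),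
      ‖h t a - h s a‖ ≤ C * |(t : ℝ) - s| ^ α := by
  obtain ⟨C₀, hC⟩ := hh
  filter_upwards [eventually_ge_atTop C₀] with C hC' s t a
  exact (hC s t a).trans (by gcongr)

variable {d : ℕ}

theorem distXM_nonneg (a b : RSp d × P2 d) : 0 ≤ distXM a b :=
  add_nonneg (norm_nonneg _) (wass2_nonneg _ _)

theorem distXMV_nonneg (a b : RSp d × P2 d × RSp d) : 0 ≤ distXMV a b :=
  add_nonneg (add_nonneg (norm_nonneg _) (wass2_nonneg _ _)) (norm_nonneg _)

theorem distXMVV_nonneg (a b : RSp d × P2 d × RSp d × RSp d) : 0 ≤ distXMVV a b :=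
  add_nonneg (add_nonneg (add_nonneg (norm_nonneg _) (wass2_nonneg _ _)) (norm_nonneg _))
    (norm_nonneg _)

variable {T α : ℝ} {V F : Type*}
  [NormedAddCommGroup V] [NormedSpace ℝ V] [NormedAddCommGroup F] [NormedSpace ℝ F]

/-- The jet of `f_t` given by versions of its L-derivatives. -/
def coeffJet (f : Icc (0 : ℝ) T → RSp d → P2 d → F)
    (dμDxf : Icc (0 : ℝ) T → RSp d → P2 d → RSp d → (RSp d →L[ℝ] RSp d →L[ℝ] F))
    (dμf : Icc (0 : ℝ) T → RSp d → P2 d → RSp d → (RSp d →L[ℝ] F))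
    (dμμf : Icc (0 : ℝ) T → RSp d → P2 d → RSp d → RSp d → (RSp d →L[ℝ] RSp d →L[ℝ] F))
    (t : Icc (0 : ℝ) T) : LiftJet d F where
  fn := f t
  dx x μ := fderiv ℝ (fun y => f t y μ) x
  dm := dμf t
  dxx x μ := fderiv ℝ (fderiv ℝ fun y => f t y μ) x
  dxm := dμDxf t
  dmx x μ v := fderiv ℝ (fun y => dμf t y μ v) x
  dmm := dμμf t
  dv x μ v := fderiv ℝ (fun w => dμf t x μ w) v

variable [MeasurableSpace F] [CompleteSpace F] {W : Icc (0 : ℝ) T → V}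
  {f : Icc (0 : ℝ) T → RSp d → P2 d → F}
  {f' : Icc (0 : ℝ) T → RSp d → P2 d → (V →L[ℝ] F)}
  {dμDxf : Icc (0 : ℝ) T → RSp d → P2 d → RSp d → (RSp d →L[ℝ] RSp d →L[ℝ] F)}
  {dμf : Icc (0 : ℝ) T → RSp d → P2 d → RSp d → (RSp d →L[ℝ] F)}
  {dμμf : Icc (0 : ℝ) T → RSp d → P2 d → RSp d → RSp d → (RSp d →L[ℝ] RSp d →L[ℝ] F)}
  {dμf' : Icc (0 : ℝ) T → RSp d → P2 d → RSp d → (RSp d →L[ℝ] V →L[ℝ] F)}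

theorem RoughCoeffWith.eventually_liftC2 (h : RoughCoeffWith α W f f' dμDxf dμf dμμf dμf') :
    ∀ᶠ K : ℝ in atTop, ∀ t, LiftC2 K K (coeffJet f dμDxf dμf dμμf t) := by
  filter_upwards [h.bounded_x.eventually, h.regular_xx.1.eventually,
    h.regular_xx.2.1.eventually distXM_nonneg, h.regular_xμ.1.eventually,
    h.regular_xμ.2.1.eventually distXMV_nonneg, h.bounded_μ.eventually,
    h.regular_vμ.1.eventually, h.regular_vμ.2.1.eventually distXMV_nonneg,
    h.regular_μμ.1.eventually, h.regular_μμ.2.1.eventually distXMVV_nonneg,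
    h.regular_μx.1.eventually, h.regular_μx.2.1.eventually distXMV_nonneg]
    with K bx bxx lxx bxμ lxμ bμ bvμ lvμ bμμ lμμ bμx lμx t
  have deriv_x : LiftC1 K K (coeffJet f dμDxf dμf dμμf t).dx (coeffJet f dμDxf dμf dμμf t).dxx
      (coeffJet f dμDxf dμf dμμf t).dxm :=
    { hasFDerivAt := fun x μ => (h.diff_xx t μ x).hasFDerivAt
      hasLDeriv := fun x => h.lDeriv_x t x
      bound_x := fun x μ => bxx t (x, μ)
      bound_m := fun x μ v => bxμ t (x, μ, v)
      lip_x := fun x μ y ν => lxx t (x, μ) (y, ν)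
      lip_m := fun x μ v y ν w => lxμ t (x, μ, v) (y, ν, w) }
  have deriv_m : ∀ v, LiftC1 K K (fun x μ => (coeffJet f dμDxf dμf dμμf t).dm x μ v)
      (fun x μ => (coeffJet f dμDxf dμf dμμf t).dmx x μ v)
      (fun x μ => (coeffJet f dμDxf dμf dμμf t).dmm x μ v) := fun v =>
    { hasFDerivAt := fun x μ => (h.diff_xμ t μ v x).hasFDerivAt
      hasLDeriv := fun x => h.lDeriv_μ t x v
      bound_x := fun x μ => bμx t (x, μ, v)
      bound_m := fun x μ v' => bμμ t (x, μ, v, v')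
      lip_x := fun x μ y ν => by
        have := lμx t (x, μ, v) (y, ν, v)
        simp only [distXMV, sub_self, norm_zero, add_zero] at this
        exact this
      lip_m := fun x μ v' y ν w' => by
        have := lμμ t (x, μ, v, v') (y, ν, v, w')
        simp only [distXMVV, sub_self, norm_zero, add_zero] at this
        exact this }
  have hasv : ∀ x μ v, HasFDerivAt ((coeffJet f dμDxf dμf dμμf t).dm x μ)
      ((coeffJet f dμDxf dμf dμμf t).dv x μ v) v := fun x μ v => (h.diff_v t x μ v).hasFDerivAt
  have boundv : ∀ x μ v, ‖(coeffJet f dμDxf dμf dμμf t).dv x μ v‖ ≤ K :=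
    fun x μ v => bvμ t (x, μ, v)
  exact
    { first :=
        { hasFDerivAt := fun x μ => (h.diff_x t μ x).hasFDerivAt
          hasLDeriv := fun x => h.lDeriv t x
          bound_x := fun x μ => bx t (x, μ)
          bound_m := fun x μ v => bμ t (x, μ, v)
          -- Lipschitz continuity of `D_x f`, and next of `∂_μ f`, is derived from the bounds on
          -- second derivatives; for `∂_μ f` the variable `v` moves last.
          lip_x := fun x μ y ν => deriv_x.norm_sub_le x μ y ν
          lip_m := fun x μ v y ν w => by
            have h1 := (deriv_m v).norm_sub_le x μ y ν
            have h2 := norm_image_sub_le_of_bound (hasv y ν) (boundv y ν) v w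
            have h3 := norm_sub_le_norm_sub_add_norm_sub (dμf t x μ v) (dμf t y ν v) (dμf t y ν w)
            calc _ ≤ _ := h3
              _ ≤ K * (‖x - y‖ + wass2 μ ν) + K * ‖v - w‖ := add_le_add h1 h2
              _ = _ := by ring }
      deriv_x := deriv_x
      deriv_m := deriv_m
      hasFDerivAt_v := hasv
      bound_v := boundv
      lip_v := fun x μ v y ν w => lvμ t (x, μ, v) (y, ν, w)
      lip_mx := fun x μ v y ν w => lμx t (x, μ, v) (y, ν, w)
      lip_mm := fun x μ v v' y ν w w' => lμμ t (x, μ, v, v') (y, ν, w, w') }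

theorem RoughCoeffWith.eventually_liftC1 (h : RoughCoeffWith α W f f' dμDxf dμf dμμf dμf') :
    ∀ᶠ K : ℝ in atTop, ∀ t,
      LiftC1 K K (f' t) (fun x μ => fderiv ℝ (fun y => f' t y μ) x) (dμf' t) := by
  filter_upwards [h.regular_x'.1.eventually, h.regular_x'.2.1.eventually distXM_nonneg,
    h.regular_μ'.1.eventually, h.regular_μ'.2.1.eventually distXMV_nonneg] with K bx lx bm lm t
  exact
    { hasFDerivAt := fun x μ => (h.diff_x' t μ x).hasFDerivAt
      hasLDeriv := fun x => h.lDeriv' t x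
      bound_x := fun x μ => bx t (x, μ)
      bound_m := fun x μ v => bm t (x, μ, v)
      lip_x := fun x μ y ν => lx t (x, μ) (y, ν)
      lip_m := fun x μ v y ν w => lm t (x, μ, v) (y, ν, w) }

/-- A path controlled by an `α`-Hölder path is `α`-Hölder. -/
theorem norm_sub_le_of_remainder {A G : Type*} [NormedAddCommGroup G] [NormedSpace ℝ G] {C K : ℝ}
    (hα : 0 < α) {u : Icc (0 : ℝ) T → A → G} {u' : Icc (0 : ℝ) T → A → (V →L[ℝ] G)}
    {B : ℝ} (hW : ∀ s t : Icc (0 : ℝ) T, ‖W t - W s‖ ≤ B * |(t : ℝ) - s| ^ α)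
    (hK : ∀ t a, ‖u' t a‖ ≤ K)
    (hC : ∀ s t : Icc (0 : ℝ) T, s < t → ∀ a,
      ‖u t a - u s a - u' s a (W t - W s)‖ ≤ C * |(t : ℝ) - s| ^ (2 * α))
    (s t : Icc (0 : ℝ) T) (hst : s < t) (a : A) :
    ‖u t a - u s a‖ ≤ (|C| * T ^ α + K * B) * |(t : ℝ) - s| ^ α := by
  have hK0 : 0 ≤ K := (norm_nonneg _).trans (hK s a)
  set r := |(t : ℝ) - s|
  have hr : r ≤ T := by
    rw [abs_le]; constructor <;> linarith [s.2.1, s.2.2, t.2.1, t.2.2]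
  have hr0 : 0 ≤ r := abs_nonneg _
  have h1 := hC s t hst a
  have h2 : C * r ^ (2 * α) ≤ |C| * T ^ α * r ^ α := by
    -- One factor `r^α` of `r^(2α)` is absorbed into `T^α`.
    rw [two_mul, Real.rpow_add_of_nonneg hr0 hα.le hα.le, ← mul_assoc]
    gcongr
    exact le_abs_self C
  have h3 : ‖u' s a (W t - W s)‖ ≤ K * (B * r ^ α) :=
    (u' s a).le_of_opNorm_le_of_le (hK s a) (hW s t)
  have h4 : u t a - u s a = (u t a - u s a - u' s a (W t - W s)) + u' s a (W t - W s) := by abel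
  rw [h4]
  refine (norm_add_le _ _).trans ?_
  linarith

/-- Hölder continuity of `f` in time is not among the assumptions; it follows from (i), boundedness
of `f'` and the regularity of `W`. The next two results do the same for `D_x f` and `∂_μ f`. -/
theorem RoughCoeffWith.exists_time_holder (h : RoughCoeffWith α W f f' dμDxf dμf dμμf dμf')
    (hα : 0 < α) (hW : ∃ C : ℝ, ∀ s t : Icc (0 : ℝ) T, ‖W t - W s‖ ≤ C * |(t : ℝ) - s| ^ α) :
    ∃ C : ℝ, ∀ s t : Icc (0 : ℝ) T, s < t → ∀ x μ, ‖f t x μ - f s x μ‖ ≤ C * |(t : ℝ) - s| ^ α := by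
  obtain ⟨B, hB⟩ := hW
  obtain ⟨C, hC⟩ := h.remainder
  obtain ⟨K, hK⟩ := h.bounded'
  exact ⟨_, fun s t hst x μ => norm_sub_le_of_remainder (A := RSp d × P2 d) hα
    (u := fun t a => f t a.1 a.2) (u' := fun t a => f' t a.1 a.2) hB hK
    (fun s t hst a => hC s t hst a.1 a.2) s t hst (x, μ)⟩

theorem RoughCoeffWith.exists_time_holder_x (h : RoughCoeffWith α W f f' dμDxf dμf dμμf dμf')
    (hα : 0 < α) (hW : ∃ C : ℝ, ∀ s t : Icc (0 : ℝ) T, ‖W t - W s‖ ≤ C * |(t : ℝ) - s| ^ α) :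
    ∃ C : ℝ, ∀ s t : Icc (0 : ℝ) T, s < t → ∀ x μ,
      ‖fderiv ℝ (fun y => f t y μ) x - fderiv ℝ (fun y => f s y μ) x‖
        ≤ C * |(t : ℝ) - s| ^ α := by
  obtain ⟨B, hB⟩ := hW
  obtain ⟨C, hC⟩ := h.remainder_x
  obtain ⟨K, hK⟩ := h.regular_x'.1
  exact ⟨_, fun s t hst x μ => norm_sub_le_of_remainder (A := RSp d × P2 d) hα
    (u := fun t a => fderiv ℝ (fun y => f t y a.2) a.1)
    (u' := fun t a => (fderiv ℝ (fun y => f' t y a.2) a.1).flip) hB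
    (fun t a => (ContinuousLinearMap.opNorm_flip _).trans_le (hK t a))
    (fun s t hst a => hC s t hst a.1 a.2) s t hst (x, μ)⟩

theorem RoughCoeffWith.exists_time_holder_μ (h : RoughCoeffWith α W f f' dμDxf dμf dμμf dμf')
    (hα : 0 < α) (hW : ∃ C : ℝ, ∀ s t : Icc (0 : ℝ) T, ‖W t - W s‖ ≤ C * |(t : ℝ) - s| ^ α) :
    ∃ C : ℝ, ∀ s t : Icc (0 : ℝ) T, s < t → ∀ x μ v,
      ‖dμf t x μ v - dμf s x μ v‖ ≤ C * |(t : ℝ) - s| ^ α := by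
  obtain ⟨B, hB⟩ := hW
  obtain ⟨C, hC⟩ := h.remainder_μ
  obtain ⟨K, hK⟩ := h.regular_μ'.1
  exact ⟨_, fun s t hst x μ v => norm_sub_le_of_remainder (A := RSp d × P2 d × RSp d) hα
    (u := fun t a => dμf t a.1 a.2.1 a.2.2) (u' := fun t a => (dμf' t a.1 a.2.1 a.2.2).flip) hB
    (fun t a => (ContinuousLinearMap.opNorm_flip _).trans_le (hK t a))
    (fun s t hst a => hC s t hst a.1 a.2.1 a.2.2) s t hst (x, μ, v)⟩

end Assumptions

/-! ### Integer parts of the orders of regularity -/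

section Orders

theorem intOrder_one : intOrder 1 = 0 := by simp [intOrder]

/-- The endpoint 3 is included because the fractional part lies in `(0, 1]`: order 3 means two
derivatives, the second Lipschitz. -/
theorem intOrder_eq_two {k : ℝ} (h : 2 < k) (h' : k ≤ 3) : intOrder k = 2 := by
  have : ⌈k⌉₊ = 3 := by
    rw [Nat.ceil_eq_iff (by norm_num)]; norm_num; exact ⟨h, h'⟩
  rw [intOrder, this]

theorem intOrder_eq_one {k : ℝ} (h : 1 < k) (h' : k ≤ 2) : intOrder k = 1 := by
  have : ⌈k⌉₊ = 2 := by
    rw [Nat.ceil_eq_iff (by norm_num)]; norm_num; exact ⟨h, h'⟩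
  rw [intOrder, this]

end Orders

/-! ### Membership of the lifted coefficients in the function spaces -/

section Main

variable {Ω : Type*} [MeasurableSpace Ω] {P : Measure Ω} [IsProbabilityMeasure P] {d : ℕ}
  {p : ℝ≥0} [Fact (1 ≤ (p : ℝ≥0∞))] {T α : ℝ} {V F : Type*}
  [NormedAddCommGroup V] [NormedSpace ℝ V] [NormedAddCommGroup F] [NormedSpace ℝ F]
  [MeasurableSpace F]

theorem HolderAlongWith.mono {E X Y : Type*} [AddCommGroup E] [Module ℝ E] [TopologicalSpace E]
    [NormedAddCommGroup X] [NormedSpace ℝ X] [NormedAddCommGroup Y] [NormedSpace ℝ Y]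
    {ι : X →L[ℝ] E} {C C' γ : ℝ} {g : E → Y} (h : HolderAlongWith ι C γ g) (hC : C ≤ C') :
    HolderAlongWith ι C' γ g := fun x ξ => (h x ξ).trans (by gcongr)

theorem BddLipCoeff.lift {g : Icc (0 : ℝ) T → RSp d → P2 d → F} (h : BddLipCoeff g)
    (hp : 2 ≤ (p : ℝ≥0∞)) :
    (∀ t, MemCkbAlong (stateEmbedding P p hp) 1 (liftCoeff P g t)) ∧
      ∃ K : ℝ, ∀ t, (∀ z, ‖liftCoeff P g t z‖ ≤ K) ∧
        HolderAlongWith (stateEmbedding P p hp) K 1 (liftCoeff P g t) := by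
  obtain ⟨K, hb, hl, hK⟩ := (h.bounded.eventually.and ((h.lipschitz.eventually
    distXM_nonneg).and (Filter.eventually_ge_atTop 0))).exists
  have key : ∀ t, (∀ z, ‖liftCoeff P g t z‖ ≤ 2 * K) ∧
      HolderAlongWith (stateEmbedding P p hp) (2 * K) 1 (liftCoeff P g t) := by
    refine fun t => ⟨fun z => (hb t (z.1, lawL2 P z.2)).trans (by linarith), fun z ξ => ?_⟩
    refine (hl t ((z + stateEmbedding P p hp ξ).1, lawL2 P (z + stateEmbedding P p hp ξ).2)
      (z.1, lawL2 P z.2)).trans ?_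
    have h1 := wass2_lawL2_snd_le (z + stateEmbedding P p hp ξ) z
    have h2 := norm_fst_sub_le (z + stateEmbedding P p hp ξ) z
    have h3 := norm_stateEmbedding_le hp ξ
    rw [add_sub_cancel_left] at h1 h2
    rw [distXM, Real.rpow_one]
    -- The factor 2 arises because the distance on `(x, μ)` is a sum while the product norm is a
    -- maximum.
    calc _ ≤ K * (‖ξ‖ + ‖ξ‖) := by gcongr <;> linarith
      _ = _ := by ring
  refine ⟨fun t => ⟨2 * K, ckbAlongWith_of_intOrder_zero intOrder_one (key t).1 ?_⟩, 2 * K, key⟩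
  have : fracOrder 1 = 1 := by simp [fracOrder, intOrder_one]
  rw [this]
  exact (key t).2

variable [CompleteSpace F] {W : Icc (0 : ℝ) T → V}
  {f : Icc (0 : ℝ) T → RSp d → P2 d → F}
  {f' : Icc (0 : ℝ) T → RSp d → P2 d → (V →L[ℝ] F)}
  {dμDxf : Icc (0 : ℝ) T → RSp d → P2 d → RSp d → (RSp d →L[ℝ] RSp d →L[ℝ] F)}
  {dμf : Icc (0 : ℝ) T → RSp d → P2 d → RSp d → (RSp d →L[ℝ] F)}
  {dμμf : Icc (0 : ℝ) T → RSp d → P2 d → RSp d → RSp d → (RSp d →L[ℝ] RSp d →L[ℝ] F)}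
  {dμf' : Icc (0 : ℝ) T → RSp d → P2 d → RSp d → (RSp d →L[ℝ] V →L[ℝ] F)}

theorem RoughCoeffWith.isControlledVectorField
    (h : RoughCoeffWith α W f f' dμDxf dμf dμμf dμf') (hα : 0 < α)
    (hW : ∃ C : ℝ, ∀ s t : Icc (0 : ℝ) T, ‖W t - W s‖ ≤ C * |(t : ℝ) - s| ^ α)
    (hp : 2 < (p : ℝ≥0∞)) :
    IsControlledVectorField (stateEmbedding P p hp.le) α (min (p : ℝ) 3) W
      (liftCoeff P f) (liftCoeff P f') := by
  obtain ⟨K, hJ, hJ', hb, hb', hK⟩ := (h.eventually_liftC2.and (h.eventually_liftC1.and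
    (h.bounded.eventually.and (h.bounded'.eventually.and (Filter.eventually_ge_atTop 0))))).exists
  set κ := min (p : ℝ) 3 with hκ
  have hp2 : (2 : ℝ) < p := by exact_mod_cast hp
  have hκ2 : 2 < κ := lt_min hp2 (by norm_num)
  have hκ3 : κ ≤ 3 := min_le_right _ _
  have ho : intOrder κ = 2 := intOrder_eq_two hκ2 hκ3
  have ho' : intOrder (κ - 1) = 1 := intOrder_eq_one (by linarith) (by linarith)
  have hfr : fracOrder κ = κ - 2 := by rw [fracOrder, ho]; norm_num
  have hfr' : fracOrder (κ - 1) = κ - 2 := by rw [fracOrder, ho']; push_cast; ring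
  -- The Hölder exponent is `θ = κ - 2 = min(p - 2, 1)`, the largest one allowed by both `2 + θ ≤ p`
  -- and `θ ≤ 1`.
  have hθ : 0 < κ - 2 := by linarith
  have hθ1 : κ - 2 ≤ 1 := by linarith
  have hpθ : 2 + (κ - 2) ≤ p := by linarith [min_le_left (p : ℝ) 3]
  set ι := stateEmbedding (d := d) P p hp.le with hι
  set J := coeffJet f dμDxf dμf dμμf with hJdef
  have hd1 : ∀ t, HasDerivAlong ι (liftCoeff P f t)
      (fun z => (liftDeriv P (J t).dx (J t).dm z).comp ι) :=
    fun t => (hJ t).first.hasDerivAlong hp.le hK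
  have hd2 : ∀ t, HasDerivAlong ι (fun z => (liftDeriv P (J t).dx (J t).dm z).comp ι)
      (fun z => ((J t).liftDeriv₂ P z).bilinearComp ι ι) :=
    fun t => (hJ t).hasDerivAlong hp.le hK hθ hθ1 hpθ
  have hd1' : ∀ t, HasDerivAlong ι (liftCoeff P f' t)
      (fun z => (liftDeriv P (fun x μ => fderiv ℝ (fun y => f' t y μ) x) (dμf' t) z).comp ι) :=
    fun t => (hJ' t).hasDerivAlong hp.le hK
  have holder : ∀ j ≤ intOrder κ, ∃ C : ℝ, ∀ s t : Icc (0 : ℝ) T, s < t → ∀ z,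
      ‖derivAlong ι j (liftCoeff P f t) z - derivAlong ι j (liftCoeff P f s) z‖
        ≤ C * |(t : ℝ) - s| ^ α := by
    intro j hj
    obtain rfl | rfl | rfl : j = 0 ∨ j = 1 ∨ j = 2 := by omega
    · obtain ⟨C, hC⟩ := h.exists_time_holder hα hW
      refine ⟨C, fun s t hst z => norm_multilinear_zero_le fun m => ?_⟩
      rw [sub_apply, derivAlong_zero_apply, derivAlong_zero_apply]
      exact hC s t hst _ _
    · obtain ⟨C₁, hC₁⟩ := h.exists_time_holder_x hα hW
      obtain ⟨C₂, hC₂⟩ := h.exists_time_holder_μ hα hW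
      refine ⟨2 * max C₁ C₂, fun s t hst z => norm_multilinear_one_le
        (A := (liftDeriv P (J t).dx (J t).dm z - liftDeriv P (J s).dx (J s).dm z).comp ι)
        (fun m => ?_) ?_⟩
      · rw [sub_apply, (hd1 t).derivAlong_one_apply,
          (hd1 s).derivAlong_one_apply]
        rfl
      · refine (norm_comp_stateEmbedding_le hp.le _).trans ?_
        rw [mul_assoc]
        refine (hJ t).first.norm_liftDeriv_sub_le_const (hJ s).first (fun x μ => ?_)
          (fun x μ v => ?_) z
        · exact (hC₁ s t hst x μ).trans (by gcongr; exact le_max_left _ _)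
        · exact (hC₂ s t hst x μ v).trans (by gcongr; exact le_max_right _ _)
    -- At top order no controlled expansion is available; time regularity of all five second
    -- derivatives is assumed directly.
    · obtain ⟨C, hxx, hxm, hmx, hmm, hv⟩ := (h.regular_xx.2.2.eventually.and
        (h.regular_xμ.2.2.eventually.and (h.regular_μx.2.2.eventually.and
          (h.regular_μμ.2.2.eventually.and h.regular_vμ.2.2.eventually)))).exists
      refine ⟨5 * C, fun s t hst z => norm_multilinear_two_le
        (A := ((J t).liftDeriv₂ P z - (J s).liftDeriv₂ P z).bilinearComp ι ι) (fun m => ?_) ?_⟩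
      · rw [sub_apply, (hd1 t).derivAlong_two_apply (hd2 t),
          (hd1 s).derivAlong_two_apply (hd2 s)]
        rfl
      · refine (norm_bilinearComp_stateEmbedding_le hp.le _).trans ?_
        rw [mul_assoc]
        exact (hJ t).norm_liftDeriv₂_sub_le_const hK (hJ s) hK (fun x μ => hxx s t (x, μ))
          (fun x μ v => hxm s t (x, μ, v)) (fun x μ v => hmx s t (x, μ, v))
          (fun x μ v w => hmm s t (x, μ, v, w)) (fun x μ v => hv s t (x, μ, v)) z
  have holder' : ∀ j ≤ intOrder κ - 1, ∃ C : ℝ, ∀ s t : Icc (0 : ℝ) T, s < t → ∀ z,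
      ‖derivAlong ι j (liftCoeff P f' t) z - derivAlong ι j (liftCoeff P f' s) z‖
        ≤ C * |(t : ℝ) - s| ^ α := by
    intro j hj
    obtain rfl | rfl : j = 0 ∨ j = 1 := by omega
    · obtain ⟨C, hC⟩ := h.holder'
      refine ⟨C, fun s t hst z => norm_multilinear_zero_le fun m => ?_⟩
      rw [sub_apply, derivAlong_zero_apply, derivAlong_zero_apply]
      exact hC s t (z.1, lawL2 P z.2)
    · obtain ⟨C, hx, hm⟩ := (h.regular_x'.2.2.eventually.and h.regular_μ'.2.2.eventually).exists
      refine ⟨2 * C, fun s t hst z => norm_multilinear_one_le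
        (A := (liftDeriv P (fun x μ => fderiv ℝ (fun y => f' t y μ) x) (dμf' t) z
          - liftDeriv P (fun x μ => fderiv ℝ (fun y => f' s y μ) x) (dμf' s) z).comp ι)
        (fun m => ?_) ?_⟩
      · rw [sub_apply, (hd1' t).derivAlong_one_apply,
          (hd1' s).derivAlong_one_apply]
        rfl
      · refine (norm_comp_stateEmbedding_le hp.le _).trans ?_
        rw [mul_assoc]
        exact (hJ' t).norm_liftDeriv_sub_le_const (hJ' s) (fun x μ => hx s t (x, μ))
          (fun x μ v => hm s t (x, μ, v)) z
  refine ⟨?_, ?_, ?_, ?_, holder, holder', ?_⟩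
  · have hM : (0 : ℝ) ≤ max (4 * K) (10 * K) := (by positivity : 0 ≤ 4 * K).trans (le_max_left _ _)
    refine ⟨5 * K + 4 * max (4 * K) (10 * K), fun t => ?_⟩
    refine ckbAlongWith_of_intOrder_two ho (fun z => ?_) (hd1 t) (fun z => ?_) (hd2 t)
      (fun z => ?_) ?_
    · exact (hb t (z.1, lawL2 P z.2)).trans (by linarith)
    · refine (norm_comp_stateEmbedding_le hp.le _).trans ?_
      exact (norm_liftDeriv_le (hJ t).first.bound_x (hJ t).first.bound_m z).trans (by linarith)
    · refine (norm_bilinearComp_stateEmbedding_le hp.le _).trans ?_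
      exact ((hJ t).norm_liftDeriv₂_le z).trans (by linarith)
    · rw [hfr]
      exact ((hJ t).holderAlongWith hp.le hK hθ hθ1 hpθ).mono (by linarith)
  · have hM : (0 : ℝ) ≤ max (4 * K) (5 * K) := (by positivity : 0 ≤ 4 * K).trans (le_max_left _ _)
    refine ⟨2 * K + max (4 * K) (5 * K), fun t => ?_⟩
    refine ckbAlongWith_of_intOrder_one ho' (fun z => ?_) (hd1' t) (fun z => ?_) ?_
    · exact (hb' t (z.1, lawL2 P z.2)).trans (by linarith)
    · refine (norm_comp_stateEmbedding_le hp.le _).trans ?_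
      exact (norm_liftDeriv_le (hJ' t).bound_x (hJ' t).bound_m z).trans (by linarith)
    · rw [hfr']
      exact ((hJ' t).holderAlongWith hp.le hK hθ hθ1).mono (by linarith)
  · intro j hj
    obtain ⟨C, hC⟩ := holder j hj
    exact stronglyMeasurable_ofFun_of_holder hα hC
  · intro j hj
    obtain ⟨C, hC⟩ := holder' j hj
    exact stronglyMeasurable_ofFun_of_holder hα hC
  · intro j hj
    obtain rfl | rfl : j = 0 ∨ j = 1 := by omega
    · obtain ⟨C, hC⟩ := h.remainder
      refine ⟨C, fun s t hst z => norm_multilinear_zero_le fun m => ?_⟩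
      rw [sub_apply, sub_apply,
        ContinuousLinearMap.compContinuousMultilinearMap_coe, Function.comp_apply,
        derivAlong_zero_apply, derivAlong_zero_apply, derivAlong_zero_apply]
      exact hC s t hst _ _
    · obtain ⟨C₁, hC₁⟩ := h.remainder_x
      obtain ⟨C₂, hC₂⟩ := h.remainder_μ
      -- Evaluation at `δW` commutes with the lifted derivative of `f'`, so the remainder is again a
      -- lifted form built from the remainders of `D_x f` and `∂_μ f`.
      refine ⟨2 * max C₁ C₂, fun s t hst z => norm_multilinear_one_le
        (A := (liftDeriv P (J t).dx (J t).dm z - liftDeriv P (J s).dx (J s).dm z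
          - (ContinuousLinearMap.apply ℝ F (W t - W s)).comp
            (liftDeriv P (fun x μ => fderiv ℝ (fun y => f' s y μ) x) (dμf' s) z)).comp ι)
        (fun m => ?_) ?_⟩
      · rw [sub_apply, sub_apply,
          ContinuousLinearMap.compContinuousMultilinearMap_coe, Function.comp_apply,
          (hd1 t).derivAlong_one_apply, (hd1 s).derivAlong_one_apply,
          (hd1' s).derivAlong_one_apply]
        rfl
      · refine (norm_comp_stateEmbedding_le hp.le _).trans ?_
        rw [mul_assoc]
        refine (hJ t).first.norm_liftDeriv_sub_sub_comp_le (hJ s).first (hJ' s) _ (fun x μ => ?_)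
          (fun x μ v => ?_) z
        · exact (hC₁ s t hst x μ).trans (by gcongr; exact le_max_left _ _)
        · exact (hC₂ s t hst x μ v).trans (by gcongr; exact le_max_right _ _)

end Main

end

theorem mainTheorem5 {d m n : ℕ} {T α : ℝ} (hT : 0 < T) (hα : 0 < α) (hα' : α ≤ 1)
    (W : Set.Icc (0 : ℝ) T → RSp n)
    (hW : ∃ C : ℝ, ∀ s t : Set.Icc (0 : ℝ) T, ‖W t - W s‖ ≤ C * |(t : ℝ) - s| ^ α)
    (b : Set.Icc (0 : ℝ) T → RSp d → P2 d → RSp d)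
    (σ : Set.Icc (0 : ℝ) T → RSp d → P2 d → (RSp m →L[ℝ] RSp d))
    (f : Set.Icc (0 : ℝ) T → RSp d → P2 d → (RSp n →L[ℝ] RSp d))
    (f' : Set.Icc (0 : ℝ) T → RSp d → P2 d → (RSp n →L[ℝ] RSp n →L[ℝ] RSp d))
    (hA : CoeffAssumptions α W b σ f f')
    {Ω : Type*} [MeasurableSpace Ω] (P : MeasureTheory.Measure Ω)
    [MeasureTheory.IsProbabilityMeasure P] (hP : IsAtomless P)
    (p : NNReal) [Fact (1 ≤ (p : ENNReal))] (hp : 2 < (p : ENNReal)) :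
    ((∀ t, MemCkbAlong (stateEmbedding P p hp.le) 1 (liftCoeff P b t)) ∧
      ∃ K : ℝ, ∀ t, (∀ z, ‖liftCoeff P b t z‖ ≤ K) ∧
        HolderAlongWith (stateEmbedding P p hp.le) K 1 (liftCoeff P b t)) ∧
    ((∀ t, MemCkbAlong (stateEmbedding P p hp.le) 1 (liftCoeff P σ t)) ∧
      ∃ K : ℝ, ∀ t, (∀ z, ‖liftCoeff P σ t z‖ ≤ K) ∧
        HolderAlongWith (stateEmbedding P p hp.le) K 1 (liftCoeff P σ t)) ∧
    IsControlledVectorField (stateEmbedding P p hp.le) α (min (p : ℝ) 3) W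
      (liftCoeff P f) (liftCoeff P f') := by
  obtain ⟨dμDxf, dμf, dμμf, dμf', h⟩ := hA.rough
  exact ⟨hA.drift.lift hp.le, hA.diffusion.lift hp.le, h.isControlledVectorField hα hW hp⟩
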